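/- There is a deterministic incremental maximum flow algorithm for unit-capacity graphs on the word RAM, and there are absolute constants $c$ and $C$ such that, for every word size of $w\ge c\log_2 n$ bits, the algorithm has the following properties. Let $V$ be a set of $n$ vertices, let $s\neq t$ be a source and a sink in $V$, and let $e_1,\dots,e_m$ be distinct directed edges on $V$ (no loops; antiparallel edges are allowed) that are inserted one after the other, online, into the initially empty graph, every edge having capacity $1$. After a set-up taking $O(1)$ time (on a memory that is initially zero), and after each insertion, the algorithm stores a maximum $s$-$t$ flow of the current graph together with its value: this is a flow $f\colon E\to\{0,1\}$ (the flow on any pair of vertices can be read off in $O(1)$ time) whose value, the net amount of flow leaving $s$, is maximum among all real-valued flows $g\colon E\to[0,1]$ that satisfy conservation at all vertices other than $s$ and $t$. If $F$ denotes the maximum flow value of the final graph $(V,\{e_1,\dots,e_m\})$, then $F<n$, so $F=O(n)$, and all $m$ insertions together take at most $C\cdot m\cdot\max\{F,1\}$ time; that is, the amortized time per insertion is $O(F)$ (and $O(1)$ if $F=0$). -/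

import Mathlib

namespace IncFlow

section Flows

variable {V : Type*} [Fintype V]

/-- Real-valued `s`-`t` flows in the directed graph with edge set `E`, every edge having
capacity one.  A flow is a function on ordered pairs of vertices that vanishes off `E`. -/
structure IsFlow (E : Set (V × V)) (s t : V) (f : V → V → ℝ) : Prop where
  nonneg : ∀ u v, 0 ≤ f u v
  capacity : ∀ u v, (u, v) ∈ E → f u v ≤ 1
  support : ∀ u v, (u, v) ∉ E → f u v = 0
  conservation : ∀ v, v ≠ s → v ≠ t → ∑ u, f u v = ∑ x, f v x

/-- The value of a flow: the net amount of flow that leaves the source `s`. -/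
noncomputable def flowValue (s : V) (f : V → V → ℝ) : ℝ :=
  ∑ v, f s v - ∑ v, f v s

/-- Maximum flows: flows whose value is largest among all real-valued flows. -/
def IsMaxFlow (E : Set (V × V)) (s t : V) (f : V → V → ℝ) : Prop :=
  IsFlow E s t f ∧ ∀ g : V → V → ℝ, IsFlow E s t g → flowValue s g ≤ flowValue s f

end Flows

/-! Word RAM with words of `w` bits, programmed in structured form, with a step count. -/

/-- The contents of the registers and of the random access memory. -/
structure State where
  reg : ℕ → ℕ
  mem : ℕ → ℕ

/-- Expressions built from the elementary operations of the machine. -/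
inductive Expr : Type
  | const (k : ℕ)
  | reg (i : ℕ)
  | load (a : Expr)
  | add (a b : Expr)
  | sub (a b : Expr)
  | mul (a b : Expr)
  | eq (a b : Expr)
  | lt (a b : Expr)

/-- The number of elementary operations in an expression. -/
def Expr.cost : Expr → ℕ
  | .const _ => 1
  | .reg _ => 1
  | .load a => a.cost + 1
  | .add a b => a.cost + b.cost + 1
  | .sub a b => a.cost + b.cost + 1
  | .mul a b => a.cost + b.cost + 1
  | .eq a b => a.cost + b.cost + 1
  | .lt a b => a.cost + b.cost + 1

/-- The value of an expression on `w`-bit words.  Subtraction stops at zero, and a comparison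
yields one if it holds and zero otherwise. -/
def Expr.eval (w : ℕ) (σ : State) : Expr → ℕ
  | .const k => k % 2 ^ w
  | .reg i => σ.reg i % 2 ^ w
  | .load a => σ.mem (a.eval w σ) % 2 ^ w
  | .add a b => (a.eval w σ + b.eval w σ) % 2 ^ w
  | .sub a b => a.eval w σ - b.eval w σ
  | .mul a b => (a.eval w σ * b.eval w σ) % 2 ^ w
  | .eq a b => (if a.eval w σ = b.eval w σ then 1 else 0) % 2 ^ w
  | .lt a b => (if a.eval w σ < b.eval w σ then 1 else 0) % 2 ^ w

/-- Programs. -/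
inductive Cmd : Type
  | skip
  | assign (i : ℕ) (e : Expr)
  | store (a e : Expr)
  | seq (c d : Cmd)
  | branch (e : Expr) (c d : Cmd)
  | loop (e : Expr) (c : Cmd)

def State.setReg (σ : State) (i x : ℕ) : State :=
  { σ with reg := Function.update σ.reg i x }

def State.setMem (σ : State) (a x : ℕ) : State :=
  { σ with mem := Function.update σ.mem a x }

/-- `Exec w c σ k σ'`: on `w`-bit words, the program `c` started in the state `σ` halts after
exactly `k` steps, in the state `σ'`.  A test succeeds if its value is not zero. -/
inductive Exec (w : ℕ) : Cmd → State → ℕ → State → Prop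
  | skip (σ : State) : Exec w .skip σ 1 σ
  | assign (σ : State) (i : ℕ) (e : Expr) :
      Exec w (.assign i e) σ (e.cost + 1) (σ.setReg i (e.eval w σ))
  | store (σ : State) (a e : Expr) :
      Exec w (.store a e) σ (a.cost + e.cost + 1) (σ.setMem (a.eval w σ) (e.eval w σ))
  | seq {σ₁ σ₂ σ₃ : State} {k l : ℕ} {c d : Cmd} :
      Exec w c σ₁ k σ₂ → Exec w d σ₂ l σ₃ → Exec w (.seq c d) σ₁ (k + l) σ₃
  | branch_true {σ₁ σ₂ : State} {k : ℕ} {e : Expr} {c d : Cmd} :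
      e.eval w σ₁ ≠ 0 → Exec w c σ₁ k σ₂ → Exec w (.branch e c d) σ₁ (e.cost + 1 + k) σ₂
  | branch_false {σ₁ σ₂ : State} {k : ℕ} {e : Expr} {c d : Cmd} :
      e.eval w σ₁ = 0 → Exec w d σ₁ k σ₂ → Exec w (.branch e c d) σ₁ (e.cost + 1 + k) σ₂
  | loop_true {σ₁ σ₂ σ₃ : State} {k l : ℕ} {e : Expr} {c : Cmd} :
      e.eval w σ₁ ≠ 0 → Exec w c σ₁ k σ₂ → Exec w (.loop e c) σ₂ l σ₃ →
      Exec w (.loop e c) σ₁ (e.cost + 1 + k + l) σ₃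
  | loop_false {σ : State} {e : Expr} {c : Cmd} :
      e.eval w σ = 0 → Exec w (.loop e c) σ (e.cost + 1) σ

/-- An incremental maximum flow algorithm: a program for the set-up, a program for one edge
insertion, and two expressions through which the maintained solution is read off the current
state (by constantly many operations and without changing the state). -/
structure Algorithm where
  setup : Cmd
  insertEdge : Cmd
  flow : Expr
  value : Expr

/-- The initial state holds `n`, `s`, `t` in the registers 0, 1, 2, and zeros elsewhere. -/
def startState (n s t : ℕ) : State where
  reg i := if i = 0 then n else if i = 1 then s else if i = 2 then t else 0
  mem _ := 0

/-- An ordered pair of vertices is handed to the machine in the registers 0 and 1. -/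
def State.withPair (σ : State) (u v : ℕ) : State :=
  (σ.setReg 0 u).setReg 1 v

/-- `Inserts w A σ es k σ'`: when the edges of the list `es` are inserted one after the other,
starting in the state `σ`, the algorithm takes `k` steps in total and ends in the state `σ'`.
The machine sees an edge only when that edge is inserted. -/
inductive Inserts (w : ℕ) (A : Algorithm) {n : ℕ} :
    State → List (Fin n × Fin n) → ℕ → State → Prop
  | nil (σ : State) : Inserts w A σ [] 0 σ
  | cons {σ₁ σ₂ σ₃ : State} {u v : Fin n} {es : List (Fin n × Fin n)} {k l : ℕ} :
      Exec w A.insertEdge (σ₁.withPair u v) k σ₂ → Inserts w A σ₂ es l σ₃ →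
      Inserts w A σ₁ ((u, v) :: es) (k + l) σ₃

/-- The function on pairs of vertices which the algorithm represents in the state `σ`. -/
def Algorithm.flowAt (A : Algorithm) (w : ℕ) (σ : State) {n : ℕ} (u v : Fin n) : ℝ :=
  (A.flow.eval w (σ.withPair u v) : ℝ)

end IncFlow

/-! The algorithm is augmenting paths with one saving: the search tree of the residual graph
survives from one insertion to the next. Between two augmentations the residual graph only grows,
and inserting `(u, v)` adds exactly the residual arc from `u` to `v`. A finished search is therefore
resumed by at most discovering `v` from `u`; nothing already scanned is scanned again. When the
search is exhausted without reaching `t`, the reached set is closed under residual arcs, so its cut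
is saturated and the flow is maximum, even among real-valued flows (`Encodes.isMaxFlow`). When `t`
has been reached, one unit is sent along the tree path (`runs_augmentLoop`) and the search starts
afresh.

Each augmentation raises the value by one, so there are at most `F + 1` searches, each of cost
linear in the number `m` of edges. Linear in `m`, not `n`: every reached vertex other than `s` has
an incident edge (`Consistent.length_queue_le`), and marks are never cleared. A vertex counts as
reached when its mark equals the current value plus one, so an augmentation makes all old marks
stale.

The bookkeeping uses the potential `m + F * (6 * m + 4) + work`, where `work ≤ 4 * m + 1`
(`Consistent.work_le`). A scanning step and an insertion each raise it by at least one. An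
augmentation loses `work` but gains `6 * m + 4`, and the surplus of at least `2 * m + 3` pays for a
path of at most `2 * m` arcs. Machine time is at most 1000 times the potential, which is at most 16
times `m * max F 1` when `m > 0`. -/

namespace IncFlow

/-! ### Unit flows, residual arcs and cuts. -/

section Networks

variable {n : ℕ}

/-- The unit flow encoded by a matrix whose entries are `0` (no edge), `1` (an edge without flow)
and `2` (an edge with flow). -/
def unitFlow (M : Fin n → Fin n → ℕ) (u v : Fin n) : ℤ := if M u v = 2 then 1 else 0

/-- The net amount of flow leaving a vertex. -/
def netFlow (M : Fin n → Fin n → ℕ) (v : Fin n) : ℤ :=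
  ∑ u, unitFlow M v u - ∑ u, unitFlow M u v

/-- Replacement of a single entry of a matrix. -/
def setEntry (M : Fin n → Fin n → ℕ) (a b : Fin n) (c : ℕ) : Fin n → Fin n → ℕ :=
  fun u v => if u = a ∧ v = b then c else M u v

/-- The arcs of the residual graph. -/
def Residual (M : Fin n → Fin n → ℕ) (u v : Fin n) : Prop := M u v = 1 ∨ M v u = 2

/-- Sending one unit of flow along a residual arc. -/
def push (M : Fin n → Fin n → ℕ) (u v : Fin n) : Fin n → Fin n → ℕ :=
  if M u v = 1 then setEntry M u v 2 else setEntry M v u 1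

theorem netFlow_setEntry (M : Fin n → Fin n → ℕ) (a b : Fin n) (c : ℕ) (v : Fin n) :
    netFlow (setEntry M a b c) v = netFlow M v +
      ((if v = a then 1 else 0) - (if v = b then 1 else 0)) *
        ((if c = 2 then 1 else 0) - unitFlow M a b) := by
  set d : ℤ := (if c = 2 then 1 else 0) - unitFlow M a b with hd
  have key : ∀ u v, unitFlow (setEntry M a b c) u v =
      unitFlow M u v + if u = a ∧ v = b then d else 0 := by
    intro u v
    by_cases h : u = a ∧ v = b
    · obtain ⟨rfl, rfl⟩ := h
      simp [unitFlow, setEntry, hd]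
    · simp [unitFlow, setEntry, h]
  have h₁ : ∑ u, (if v = a ∧ u = b then d else 0) = if v = a then d else 0 := by
    by_cases h : v = a <;> simp [h]
  have h₂ : ∑ u, (if u = a ∧ v = b then d else 0) = if v = b then d else 0 := by
    by_cases h : v = b <;> simp [h]
  simp only [netFlow, key, Finset.sum_add_distrib, h₁, h₂]
  split_ifs <;> ring

theorem netFlow_push {M : Fin n → Fin n → ℕ} {x y : Fin n} (h : Residual M x y) (v : Fin n) :
    netFlow (push M x y) v =
      netFlow M v + (if v = x then 1 else 0) - (if v = y then 1 else 0) := by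
  by_cases h₁ : M x y = 1
  · simp [push, h₁, netFlow_setEntry, unitFlow]
    ring
  · have h₂ : M y x = 2 := h.resolve_left h₁
    simp [push, h₁, netFlow_setEntry, unitFlow, h₂]
    ring

/-- The matrix `M` encodes a flow of value `F` in the graph with edge list `L`. -/
structure Encodes (s t : Fin n) (L : List (Fin n × Fin n)) (M : Fin n → Fin n → ℕ) (F : ℕ) :
    Prop where
  le_two : ∀ u v, M u v ≤ 2
  eq_zero : ∀ u v, M u v = 0 ↔ (u, v) ∉ L
  conservation : ∀ v, v ≠ s → v ≠ t → netFlow M v = 0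
  value : netFlow M s = F

theorem push_le_two {M : Fin n → Fin n → ℕ} (h : ∀ u v, M u v ≤ 2) (x y u v : Fin n) :
    push M x y u v ≤ 2 := by
  by_cases h₁ : M x y = 1
  · simp only [push, h₁, if_true, setEntry]
    split_ifs <;> simp [h]
  · simp only [push, h₁, if_false, setEntry]
    split_ifs <;> simp [h]

theorem push_eq_zero {M : Fin n → Fin n → ℕ} {x y : Fin n} (h : Residual M x y) (u v : Fin n) :
    push M x y u v = 0 ↔ M u v = 0 := by
  by_cases h₁ : M x y = 1
  · simp only [push, h₁, if_true, setEntry]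
    split_ifs with h₂
    · obtain ⟨rfl, rfl⟩ := h₂; simp [h₁]
    · rfl
  · have h₂ : M y x = 2 := h.resolve_left h₁
    simp only [push, h₁, if_false, setEntry]
    split_ifs with h₃
    · obtain ⟨rfl, rfl⟩ := h₃; simp [h₂]
    · rfl

/-- Whichever entry a push alters, the head `y` of the arc is one of its indices. This protects the
arcs nearer the source while a path is augmented from its far end. -/
theorem push_of_ne {M : Fin n → Fin n → ℕ} {x y u v : Fin n} (hu : u ≠ y) (hv : v ≠ y) :
    push M x y u v = M u v := by
  unfold push setEntry
  split_ifs <;> simp_all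

theorem netFlow_cast (M : Fin n → Fin n → ℕ) (v : Fin n) :
    (netFlow M v : ℝ) = ∑ u, (unitFlow M v u : ℝ) - ∑ u, (unitFlow M u v : ℝ) := by
  simp [netFlow]

theorem Encodes.isFlow {s t : Fin n} {L : List (Fin n × Fin n)} {M : Fin n → Fin n → ℕ} {F : ℕ}
    (h : Encodes s t L M F) : IsFlow {e | e ∈ L} s t (fun u v => (unitFlow M u v : ℝ)) where
  nonneg u v := by unfold unitFlow; split_ifs <;> simp
  capacity u v _ := by unfold unitFlow; split_ifs <;> simp
  support u v huv := by
    have : M u v = 0 := (h.eq_zero u v).2 huv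
    simp [unitFlow, this]
  conservation v hs ht := by
    have h₁ := netFlow_cast M v
    rw [h.conservation v hs ht] at h₁
    push_cast at h₁
    linarith

theorem Encodes.flowValue_eq {s t : Fin n} {L : List (Fin n × Fin n)} {M : Fin n → Fin n → ℕ}
    {F : ℕ} (h : Encodes s t L M F) : flowValue s (fun u v => (unitFlow M u v : ℝ)) = F := by
  have h₁ := netFlow_cast M s
  rw [h.value] at h₁
  simp only [flowValue]
  rw [← h₁]
  simp

/-- The value of a flow is the net flow across any cut. -/
theorem IsFlow.value_eq_cut {E : Set (Fin n × Fin n)} {s t : Fin n} {g : Fin n → Fin n → ℝ}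
    (hg : IsFlow E s t g) (R : Finset (Fin n)) (hs : s ∈ R) (ht : t ∉ R) :
    flowValue s g = ∑ v ∈ R, ∑ u ∈ Rᶜ, (g v u - g u v) := by
  have h₁ : ∑ v ∈ R, (∑ u, g v u - ∑ u, g u v) = flowValue s g := by
    rw [Finset.sum_eq_single_of_mem s hs]
    · rfl
    · intro v hv hvs
      rw [hg.conservation v hvs (fun h => ht (h ▸ hv))]
      ring
  have h₂ : ∑ v ∈ R, ∑ u ∈ R, (g v u - g u v) = 0 := by
    simp only [Finset.sum_sub_distrib]
    rw [Finset.sum_comm, sub_self]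
  rw [← h₁, ← zero_add (∑ v ∈ R, ∑ u ∈ Rᶜ, (g v u - g u v)), ← h₂, ← Finset.sum_add_distrib]
  refine Finset.sum_congr rfl fun v _ => ?_
  rw [Finset.sum_add_sum_compl, Finset.sum_sub_distrib]

/-- Weak duality across the cut `R`: an arc leaving `R` is not residual, so existing edges out of
`R` carry flow 1 and edges into `R` carry 0. Termwise no feasible flow can do better. -/
theorem Encodes.isMaxFlow {s t : Fin n} {L : List (Fin n × Fin n)} {M : Fin n → Fin n → ℕ}
    {F : ℕ} (h : Encodes s t L M F) (R : Finset (Fin n)) (hs : s ∈ R) (ht : t ∉ R)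
    (hR : ∀ u ∈ R, ∀ v, Residual M u v → v ∈ R) :
    IsMaxFlow {e | e ∈ L} s t (fun u v => (unitFlow M u v : ℝ)) := by
  refine ⟨h.isFlow, fun g hg => ?_⟩
  rw [hg.value_eq_cut R hs ht, h.isFlow.value_eq_cut R hs ht]
  refine Finset.sum_le_sum fun v hv => Finset.sum_le_sum fun u hu => ?_
  have hres : ¬ Residual M v u := fun hc => (Finset.mem_compl.1 hu) (hR v hv u hc)
  simp only [Residual, not_or] at hres
  have h₁ : unitFlow M u v = 0 := by simp [unitFlow, hres.2]
  have h₂ := hg.nonneg u v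
  by_cases hE : (v, u) ∈ L
  · have h₃ : M v u = 2 := by
      have := h.le_two v u
      have := (h.eq_zero v u).not.2 (not_not.2 hE)
      have := hres.1
      omega
    have h₄ : unitFlow M v u = 1 := by simp [unitFlow, h₃]
    have := hg.capacity v u hE
    simp only [h₁, h₄]
    push_cast
    linarith
  · have h₃ : M v u = 0 := (h.eq_zero v u).2 hE
    have h₄ : unitFlow M v u = 0 := by simp [unitFlow, h₃]
    have := hg.support v u hE
    simp only [h₁, h₄]
    push_cast
    linarith

/-- The value is at most the out-degree of `s`, and without loops the entry at `(s, s)` contributes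
nothing. -/
theorem Encodes.value_lt {s t : Fin n} {L : List (Fin n × Fin n)} {M : Fin n → Fin n → ℕ}
    {F : ℕ} (h : Encodes s t L M F) (hL : ∀ e ∈ L, e.1 ≠ e.2) : F < n := by
  have h₁ : ∑ u, unitFlow M s u < ∑ _u : Fin n, (1 : ℤ) := by
    refine Finset.sum_lt_sum (fun u _ => ?_) ⟨s, Finset.mem_univ s, ?_⟩
    · unfold unitFlow; split_ifs <;> simp
    · have : M s s = 0 := (h.eq_zero s s).2 fun hc => hL _ hc rfl
      simp [unitFlow, this]
  have h₂ : 0 ≤ ∑ u, unitFlow M u s :=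
    Finset.sum_nonneg fun u _ => by unfold unitFlow; split_ifs <;> simp
  have h₃ := h.value
  simp only [netFlow] at h₃
  simp at h₁
  omega

end Networks

/-! ### Upper bounds on running time and evaluation without overflow. -/

section Machine

/-- The program `c` leads from `σ` to `σ'` in at most `K` steps. -/
def Runs (w : ℕ) (c : Cmd) (σ : State) (K : ℕ) (σ' : State) : Prop :=
  ∃ k ≤ K, Exec w c σ k σ'

variable {w : ℕ} {σ σ₁ σ₂ σ₃ : State}

theorem Runs.mono {c : Cmd} {K K' : ℕ} (h : Runs w c σ₁ K σ₂) (hK : K ≤ K') :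
    Runs w c σ₁ K' σ₂ :=
  let ⟨k, hk, he⟩ := h
  ⟨k, hk.trans hK, he⟩

theorem Runs.skip : Runs w .skip σ 1 σ := ⟨1, le_rfl, .skip σ⟩

theorem Runs.assign {i : ℕ} {e : Expr} {x : ℕ} (h : e.eval w σ = x) :
    Runs w (.assign i e) σ (e.cost + 1) (σ.setReg i x) :=
  ⟨_, le_rfl, h ▸ .assign σ i e⟩

theorem Runs.store {a e : Expr} {x y : ℕ} (ha : a.eval w σ = x) (he : e.eval w σ = y) :
    Runs w (.store a e) σ (a.cost + e.cost + 1) (σ.setMem x y) :=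
  ⟨_, le_rfl, ha ▸ he ▸ .store σ a e⟩

theorem Runs.seq {c d : Cmd} {K K' : ℕ} (h : Runs w c σ₁ K σ₂) (h' : Runs w d σ₂ K' σ₃) :
    Runs w (.seq c d) σ₁ (K + K') σ₃ :=
  let ⟨_, hk, he⟩ := h
  let ⟨_, hk', he'⟩ := h'
  ⟨_, add_le_add hk hk', .seq he he'⟩

theorem Runs.branch_true {c d : Cmd} {e : Expr} {K : ℕ} (he : e.eval w σ₁ ≠ 0)
    (h : Runs w c σ₁ K σ₂) : Runs w (.branch e c d) σ₁ (e.cost + 1 + K) σ₂ :=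
  let ⟨_, hk, hc⟩ := h
  ⟨_, by omega, .branch_true he hc⟩

theorem Runs.branch_false {c d : Cmd} {e : Expr} {K : ℕ} (he : e.eval w σ₁ = 0)
    (h : Runs w d σ₁ K σ₂) : Runs w (.branch e c d) σ₁ (e.cost + 1 + K) σ₂ :=
  let ⟨_, hk, hc⟩ := h
  ⟨_, by omega, .branch_false he hc⟩

theorem Runs.loop_true {c : Cmd} {e : Expr} {K K' : ℕ} (he : e.eval w σ₁ ≠ 0)
    (h : Runs w c σ₁ K σ₂) (h' : Runs w (.loop e c) σ₂ K' σ₃) :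
    Runs w (.loop e c) σ₁ (e.cost + 1 + K + K') σ₃ :=
  let ⟨_, hk, hc⟩ := h
  let ⟨_, hk', hc'⟩ := h'
  ⟨_, by omega, .loop_true he hc hc'⟩

theorem Runs.loop_false {c : Cmd} {e : Expr} (he : e.eval w σ = 0) :
    Runs w (.loop e c) σ (e.cost + 1) σ := ⟨_, le_rfl, .loop_false he⟩

@[simp] theorem State.setReg_reg (σ : State) (i x j : ℕ) :
    (σ.setReg i x).reg j = if j = i then x else σ.reg j := by
  simp [State.setReg, Function.update_apply]

@[simp] theorem State.setReg_mem (σ : State) (i x : ℕ) : (σ.setReg i x).mem = σ.mem := rfl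

@[simp] theorem State.setMem_reg (σ : State) (a x : ℕ) : (σ.setMem a x).reg = σ.reg := rfl

@[simp] theorem State.setMem_mem (σ : State) (a x : ℕ) :
    (σ.setMem a x).mem = Function.update σ.mem a x := rfl

theorem eval_const {k : ℕ} (h : k < 2 ^ w) : (Expr.const k).eval w σ = k := Nat.mod_eq_of_lt h

theorem eval_reg {i x : ℕ} (h : σ.reg i = x) (hx : x < 2 ^ w) : (Expr.reg i).eval w σ = x := by
  subst h; exact Nat.mod_eq_of_lt hx

theorem eval_load {a : Expr} {x y : ℕ} (ha : a.eval w σ = x) (h : σ.mem x = y)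
    (hy : y < 2 ^ w) : (Expr.load a).eval w σ = y := by
  subst ha h; exact Nat.mod_eq_of_lt hy

theorem eval_add {a b : Expr} {x y : ℕ} (ha : a.eval w σ = x) (hb : b.eval w σ = y)
    (h : x + y < 2 ^ w) : (Expr.add a b).eval w σ = x + y := by
  subst ha hb; exact Nat.mod_eq_of_lt h

theorem eval_sub {a b : Expr} {x y : ℕ} (ha : a.eval w σ = x) (hb : b.eval w σ = y) :
    (Expr.sub a b).eval w σ = x - y := by
  subst ha hb; rfl

theorem eval_mul {a b : Expr} {x y : ℕ} (ha : a.eval w σ = x) (hb : b.eval w σ = y)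
    (h : x * y < 2 ^ w) : (Expr.mul a b).eval w σ = x * y := by
  subst ha hb; exact Nat.mod_eq_of_lt h

theorem eval_eq {a b : Expr} {x y : ℕ} (hw : 1 < 2 ^ w) (ha : a.eval w σ = x)
    (hb : b.eval w σ = y) : (Expr.eq a b).eval w σ = if x = y then 1 else 0 := by
  subst ha hb
  simp only [Expr.eval]
  split_ifs
  · exact Nat.mod_eq_of_lt hw
  · exact Nat.zero_mod _

theorem eval_lt {a b : Expr} {x y : ℕ} (hw : 1 < 2 ^ w) (ha : a.eval w σ = x)
    (hb : b.eval w σ = y) : (Expr.lt a b).eval w σ = if x < y then 1 else 0 := by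
  subst ha hb
  simp only [Expr.eval]
  split_ifs
  · exact Nat.mod_eq_of_lt hw
  · exact Nat.zero_mod _

end Machine

/-! ### Memory addresses and the required word size. -/

section Layout

variable {n w : ℕ} {σ : State}

/-- The address of the cell with index `j` in the `k`-th of six interleaved arrays: the matrix
of edges and flows, the lists of neighbours, their lengths, the marks of the visited vertices,
their parents, and the queue. -/
def cell (k : Fin 6) (j : ℕ) : ℕ := 6 * j + k

/-- The index of a pair in a two-dimensional array. -/
def pairIndex (n a b : ℕ) : ℕ := a * n + b

@[simp] theorem cell_inj (k k' : Fin 6) (j j' : ℕ) : cell k j = cell k' j' ↔ k = k' ∧ j = j' := by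
  unfold cell
  rw [Fin.ext_iff]
  omega

-- Only the second coordinate has to lie below `n`. Neighbour lists are indexed by position first
-- and vertex second, so their lengths may exceed `n`.
@[simp] theorem pairIndex_inj (a a' : ℕ) (b b' : Fin n) :
    pairIndex n a b = pairIndex n a' b' ↔ a = a' ∧ b = b' := by
  refine ⟨fun h => ?_, fun ⟨h, h'⟩ => h ▸ h' ▸ rfl⟩
  unfold pairIndex at h
  have hn : 0 < n := b.pos
  have h₁ : a = a' := by
    have := congrArg (· / n) h
    simpa [mul_comm _ n, Nat.mul_add_div hn, Nat.div_eq_of_lt] using this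
  subst h₁
  exact ⟨rfl, Fin.ext (by omega)⟩

/-- Words that are long enough for the addresses and the values in use. -/
structure WideWords (n w : ℕ) : Prop where
  two_le : 2 ≤ n
  le_pow : 64 * n ^ 5 ≤ 2 ^ w

/-- As `n ≥ 2`, the factor 64 is at most `n ^ 6`; hence the exponent 6 + 5 = 11. -/
theorem WideWords.of_pow_le (hn : 2 ≤ n) (h : n ^ 11 ≤ 2 ^ w) : WideWords n w := by
  refine ⟨hn, le_trans ?_ h⟩
  calc 64 * n ^ 5 = 2 ^ 6 * n ^ 5 := by norm_num
    _ ≤ n ^ 6 * n ^ 5 := Nat.mul_le_mul_right _ (Nat.pow_le_pow_left hn 6)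
    _ = n ^ 11 := by ring

/-- The largest index comes from the neighbour lists: a position up to `2 * n ^ 2`, times `n`, plus
a vertex. -/
theorem WideWords.cell_lt (hw : WideWords n w) {j : ℕ} (hj : j ≤ 2 * n ^ 3 + n) (k : Fin 6) :
    6 * j < 2 ^ w ∧ 6 * j + k < 2 ^ w := by
  have h := hw.le_pow
  have h₁ : n ^ 3 * 4 ≤ n ^ 3 * n ^ 2 := Nat.mul_le_mul_left _ (by nlinarith [hw.two_le])
  have h₂ : n * 1 ≤ n * n ^ 2 := Nat.mul_le_mul_left _ (by nlinarith [hw.two_le])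
  have h₃ : n ^ 3 * n ^ 2 = n ^ 5 := by ring
  have h₄ : n * n ^ 2 = n ^ 3 := by ring
  have := k.isLt
  have := hw.two_le
  omega

theorem WideWords.lt (hw : WideWords n w) {x : ℕ} (hx : x ≤ 2 * n ^ 2 + 1) : x < 2 ^ w := by
  have h := hw.le_pow
  have h₁ : n ^ 2 * 8 ≤ n ^ 2 * n ^ 3 :=
    Nat.mul_le_mul_left _ (Nat.pow_le_pow_left hw.two_le 3)
  have h₂ : n ^ 2 * n ^ 3 = n ^ 5 := by ring
  have h₃ : 0 < n ^ 2 := by have := hw.two_le; positivity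
  omega

theorem WideWords.le_bound (hw : WideWords n w) {x : ℕ} (hx : x ≤ 2 * n + 2) :
    x ≤ 2 * n ^ 2 + 1 := by
  nlinarith [hw.two_le]

theorem WideWords.one_lt (hw : WideWords n w) : 1 < 2 ^ w := hw.lt (by omega)

theorem WideWords.eval_const (hw : WideWords n w) {k : ℕ} (hk : k ≤ 6) :
    (Expr.const k).eval w σ = k :=
  IncFlow.eval_const (hw.lt (hw.le_bound (by have := hw.two_le; omega)))

def cellExpr (k : Fin 6) (e : Expr) : Expr := .add (.mul (.const 6) e) (.const k)

def pairExpr (a b : Expr) : Expr := .add (.mul a (.reg 3)) b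

theorem WideWords.eval_cellExpr (hw : WideWords n w) {k : Fin 6} {e : Expr} {j : ℕ}
    (he : e.eval w σ = j) (hj : j ≤ 2 * n ^ 3 + n) : (cellExpr k e).eval w σ = cell k j :=
  eval_add (eval_mul (hw.eval_const le_rfl) he (hw.cell_lt hj k).1)
    (hw.eval_const (by omega)) (hw.cell_lt hj k).2

theorem pairIndex_le {x u : ℕ} (hx : x ≤ 2 * n ^ 2) (hu : u < n) :
    pairIndex n x u ≤ 2 * n ^ 3 + n := by
  have : x * n ≤ 2 * n ^ 2 * n := Nat.mul_le_mul_right _ hx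
  have : 2 * n ^ 2 * n = 2 * n ^ 3 := by ring
  unfold pairIndex
  omega

theorem WideWords.eval_pairExpr (hw : WideWords n w) (hn : σ.reg 3 = n) {a b : Expr} {x u : ℕ}
    (ha : a.eval w σ = x) (hb : b.eval w σ = u) (hx : x ≤ 2 * n ^ 2) (hu : u < n) :
    (pairExpr a b).eval w σ = pairIndex n x u := by
  have h := (hw.cell_lt (pairIndex_le hx hu) 0).1
  unfold pairIndex at h
  exact eval_add (eval_mul ha (eval_reg hn (hw.lt (hw.le_bound (by omega)))) (by omega)) hb
    (by omega)

theorem WideWords.eval_cellExpr_single (hw : WideWords n w) {k : Fin 6} {e : Expr} {j : ℕ}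
    (he : e.eval w σ = j) (hj : j ≤ 2 * n + 2) : (cellExpr k e).eval w σ = cell k j :=
  hw.eval_cellExpr he (by
    have : n * 4 ≤ n * n ^ 2 := Nat.mul_le_mul_left _ (by nlinarith [hw.two_le])
    have : n * n ^ 2 = n ^ 3 := by ring
    have := hw.two_le
    omega)

theorem WideWords.eval_cellExpr_pair (hw : WideWords n w) (hn : σ.reg 3 = n) {k : Fin 6}
    {a b : Expr} {x u : ℕ} (ha : a.eval w σ = x) (hb : b.eval w σ = u) (hx : x ≤ 2 * n ^ 2)
    (hu : u < n) : (cellExpr k (pairExpr a b)).eval w σ = cell k (pairIndex n x u) :=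
  hw.eval_cellExpr (hw.eval_pairExpr hn ha hb hx hu) (pairIndex_le hx hu)

theorem WideWords.eval_vertex (hw : WideWords n w) {i : ℕ} {v : Fin n} (h : σ.reg i = v) :
    (Expr.reg i).eval w σ = v :=
  eval_reg h (hw.lt (hw.le_bound (by omega)))

theorem WideWords.vertex_le (hw : WideWords n w) (v : Fin n) : (v : ℕ) ≤ 2 * n ^ 2 := by
  have := hw.two_le
  have := v.isLt
  nlinarith

end Layout

/-! ### The abstract model and its image in memory. -/

section Representation

variable {n : ℕ}

/-- The abstract state of the algorithm: the matrix of edges and flows, the lists of neighbours,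
the vertices reached by the current search in the order of their discovery, their parents, the
position of the search (`i` neighbours of the vertex at position `head` have been examined),
and the value of the flow. -/
structure Model (n : ℕ) where
  M : Fin n → Fin n → ℕ
  adj : Fin n → List (Fin n)
  queue : List (Fin n)
  par : Fin n → Fin n
  head : ℕ
  i : ℕ
  F : ℕ

def Model.visit (S : Model n) (u v : Fin n) : Model n :=
  { S with queue := S.queue ++ [v], par := Function.update S.par v u }

def Model.addNeighbor (S : Model n) (u v : Fin n) : Model n :=
  { S with adj := Function.update S.adj u (S.adj u ++ [v]) }

def Model.setMatrix (S : Model n) (M : Fin n → Fin n → ℕ) : Model n := { S with M := M }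

def Model.advance (S : Model n) : Model n := { S with i := S.i + 1 }

def Model.nextVertex (S : Model n) : Model n := { S with head := S.head + 1, i := 0 }

/-- Raising `F` also changes the current mark. Old parents may stay, since only parents of vertices
in the queue are ever used. -/
def Model.restart (S : Model n) (s : Fin n) : Model n :=
  { S with queue := [s], head := 0, i := 0, F := S.F + 1 }

/-- The memory `m` holds the arrays of the model `S`. -/
structure MemRep (m : ℕ → ℕ) (S : Model n) : Prop where
  matrix : ∀ u v : Fin n, m (cell 0 (pairIndex n u v)) = S.M u v
  neighbor : ∀ (u : Fin n) (j : ℕ) (h : j < (S.adj u).length),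
    m (cell 1 (pairIndex n j u)) = (S.adj u)[j]
  degree : ∀ u : Fin n, m (cell 2 u) = (S.adj u).length
  mark_le : ∀ u : Fin n, m (cell 3 u) ≤ S.F + 1
  mark : ∀ u : Fin n, m (cell 3 u) = S.F + 1 ↔ u ∈ S.queue
  parent : ∀ u : Fin n, m (cell 4 u) = S.par u
  queue : ∀ (j : ℕ) (h : j < S.queue.length), m (cell 5 j) = S.queue[j]

theorem MemRep.setMatrix {m : ℕ → ℕ} {S : Model n} (h : MemRep m S) (u v : Fin n) (x : ℕ) :
    MemRep (Function.update m (cell 0 (pairIndex n u v)) x)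
      (S.setMatrix (setEntry S.M u v x)) where
  matrix a b := by
    simp only [Function.update_apply, cell_inj, pairIndex_inj, Fin.val_inj, true_and, h.matrix,
      Model.setMatrix, setEntry]
  neighbor a j hj := by
    simp only [Function.update_apply, cell_inj, Fin.reduceEq, false_and, if_false]
    exact h.neighbor a j hj
  degree a := by simpa [Function.update_apply, Model.setMatrix] using h.degree a
  mark_le a := by simpa [Function.update_apply, Model.setMatrix] using h.mark_le a
  mark a := by simpa [Function.update_apply, Model.setMatrix] using h.mark a
  parent a := by simpa [Function.update_apply, Model.setMatrix] using h.parent a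
  queue j hj := by
    simp only [Function.update_apply, cell_inj, Fin.reduceEq, false_and, if_false]
    exact h.queue j hj

theorem MemRep.addNeighbor {m : ℕ → ℕ} {S : Model n} (h : MemRep m S) (u v : Fin n) :
    MemRep (Function.update (Function.update m (cell 1 (pairIndex n (S.adj u).length u)) v)
      (cell 2 u) ((S.adj u).length + 1)) (S.addNeighbor u v) where
  matrix a b := by simpa [Function.update_apply, Model.addNeighbor] using h.matrix a b
  neighbor a j hj := by
    by_cases ha : a = u
    · subst ha
      simp only [Model.addNeighbor, Function.update_self, List.length_append, List.length_cons,
        List.length_nil] at hj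
      by_cases hj' : j < (S.adj a).length
      · simp [Model.addNeighbor, hj', hj'.ne,
          h.neighbor a j hj']
      · have : j = (S.adj a).length := by omega
        subst this
        simp [Model.addNeighbor]
    · have : (S.addNeighbor u v).adj a = S.adj a := by simp [Model.addNeighbor, ha]
      simp only [this] at hj ⊢
      simpa [Function.update_apply, ha] using h.neighbor a j hj
  degree a := by
    by_cases ha : a = u
    · subst ha
      simp [Model.addNeighbor]
    · simpa [Function.update_apply, Model.addNeighbor, Fin.val_inj, ha] using h.degree a
  mark_le a := by simpa [Function.update_apply, Model.addNeighbor] using h.mark_le a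
  mark a := by simpa [Function.update_apply, Model.addNeighbor] using h.mark a
  parent a := by simpa [Function.update_apply, Model.addNeighbor] using h.parent a
  queue j hj := by
    simp only [Function.update_apply, cell_inj, Fin.reduceEq, false_and, if_false]
    exact h.queue j hj

theorem MemRep.visit {m : ℕ → ℕ} {S : Model n} (h : MemRep m S) (u v : Fin n) :
    MemRep (Function.update (Function.update (Function.update m (cell 3 v) (S.F + 1))
      (cell 4 v) u) (cell 5 S.queue.length) v) (S.visit u v) where
  matrix a b := by simpa [Function.update_apply, Model.visit] using h.matrix a b
  neighbor a j hj := by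
    simp only [Function.update_apply, cell_inj, Fin.reduceEq, false_and, if_false]
    exact h.neighbor a j hj
  degree a := by simpa [Function.update_apply, Model.visit] using h.degree a
  mark_le a := by
    have := h.mark_le a
    simp only [Function.update_apply, cell_inj, Model.visit]
    simp only [Fin.reduceEq, false_and, if_false]
    split_ifs <;> omega
  mark a := by
    have := h.mark a
    by_cases ha : a = v
    · simp [Model.visit, ha]
    · simpa [Function.update_apply, Model.visit, Fin.val_inj, ha] using this
  parent a := by
    by_cases ha : a = v
    · simp [Model.visit, ha]
    · simpa [Function.update_apply, Model.visit, Fin.val_inj, ha] using h.parent a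
  queue j hj := by
    simp only [Model.visit, List.length_append, List.length_cons, List.length_nil] at hj
    by_cases hj' : j < S.queue.length
    · simp [Model.visit, hj', hj'.ne, h.queue j hj']
    · have : j = S.queue.length := by omega
      subst this
      simp [Model.visit]

/-- By `mark_le` no cell can already hold `F + 2`, so marking `s` alone represents the new queue and
no clearing is needed. -/
theorem MemRep.restart {m : ℕ → ℕ} {S : Model n} (h : MemRep m S) (s : Fin n) :
    MemRep (Function.update (Function.update m (cell 5 0) s) (cell 3 s) (S.F + 2))
      (S.restart s) where
  matrix a b := by simpa [Function.update_apply, Model.restart] using h.matrix a b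
  neighbor a j hj := by
    simp only [Function.update_apply, cell_inj, Fin.reduceEq, false_and, if_false]
    exact h.neighbor a j hj
  degree a := by simpa [Function.update_apply, Model.restart] using h.degree a
  mark_le a := by
    have := h.mark_le a
    simp only [Function.update_apply, cell_inj, Model.restart]
    simp only [Fin.reduceEq, false_and, if_false]
    split_ifs <;> omega
  mark a := by
    have := h.mark_le a
    by_cases ha : a = s
    · simp [Model.restart, ha]
    · have : m (cell 3 a) ≠ S.F + 1 + 1 := by omega
      simpa [Function.update_apply, Model.restart, Fin.val_inj, ha] using this
  parent a := by simpa [Function.update_apply, Model.restart] using h.parent a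
  queue j hj := by
    have : j = 0 := by simpa [Model.restart] using hj
    subst this
    simp [Model.restart]

/-- The machine state `σ` represents the model `S`. -/
structure Represents (s t : Fin n) (σ : State) (S : Model n) : Prop where
  mem : MemRep σ.mem S
  sink : σ.reg 2 = t
  size : σ.reg 3 = n
  source : σ.reg 4 = s
  value : σ.reg 5 = S.F
  head : σ.reg 6 = S.head
  tail : σ.reg 7 = S.queue.length
  position : σ.reg 8 = S.i

/-- Registers 0, 1 and those above 8 are scratch space. -/
theorem Represents.setReg {s t : Fin n} {σ : State} {S : Model n} (h : Represents s t σ S)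
    {i : ℕ} (x : ℕ) (hi : i < 2 ∨ 8 < i) : Represents s t (σ.setReg i x) S := by
  obtain ⟨h, h₂, h₃, h₄, h₅, h₆, h₇, h₈⟩ := h
  have := hi
  constructor <;> first | exact h | (rw [State.setReg_reg, if_neg (by omega)]; assumption)

/-- The numbers in the model fit into words. -/
structure Fits (S : Model n) : Prop where
  matrix : ∀ u v, S.M u v ≤ 2
  degree : ∀ u, (S.adj u).length ≤ 2 * n ^ 2
  queue : S.queue.length ≤ n
  head : S.head ≤ n
  position : S.i ≤ 2 * n ^ 2
  value : S.F < n

end Representation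

/-! ### The program. -/

section Program

def matrixExpr (a b : Expr) : Expr := .load (cellExpr 0 (pairExpr a b))

def markExpr (a : Expr) : Expr := .load (cellExpr 3 a)

/-- The mark of the vertices which the current search has reached. -/
def currentMark : Expr := .add (.reg 5) (.const 1)

/-- The vertex in register 10 is discovered from the vertex in register 9. -/
def visitCmd : Cmd :=
  .seq (.store (cellExpr 3 (.reg 10)) currentMark) <|
  .seq (.store (cellExpr 4 (.reg 10)) (.reg 9)) <|
  .seq (.store (cellExpr 5 (.reg 7)) (.reg 10)) <|
  .assign 7 (.add (.reg 7) (.const 1))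

/-- One unit of flow is sent along the residual arc from register 10 to register 9. -/
def pushCmd : Cmd :=
  .branch (.eq (matrixExpr (.reg 10) (.reg 9)) (.const 1))
    (.store (cellExpr 0 (pairExpr (.reg 10) (.reg 9))) (.const 2))
    (.store (cellExpr 0 (pairExpr (.reg 9) (.reg 10))) (.const 1))

/-- One step of the search. -/
def scanCmd : Cmd :=
  .seq (.assign 9 (.load (cellExpr 5 (.reg 6)))) <|
  .branch (.lt (.reg 8) (.load (cellExpr 2 (.reg 9))))
    (.seq (.assign 10 (.load (cellExpr 1 (pairExpr (.reg 8) (.reg 9))))) <|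
      .seq (.assign 8 (.add (.reg 8) (.const 1))) <|
      .branch (.mul (.lt (markExpr (.reg 10)) currentMark)
          (.add (.eq (matrixExpr (.reg 9) (.reg 10)) (.const 1))
            (.eq (matrixExpr (.reg 10) (.reg 9)) (.const 2))))
        visitCmd .skip)
    (.seq (.assign 6 (.add (.reg 6) (.const 1))) (.assign 8 (.const 0)))

/-- One unit of flow is sent from the source to the vertex in register 9. -/
def augmentLoop : Cmd :=
  .loop (.sub (.const 1) (.eq (.reg 9) (.reg 4))) <|
    .seq (.assign 10 (.load (cellExpr 4 (.reg 9)))) <| .seq pushCmd (.assign 9 (.reg 10))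

/-- The mark of `s` is written while register 5 still holds the old value, hence the constant 2. -/
def restartCmd : Cmd :=
  .seq (.store (cellExpr 5 (.const 0)) (.reg 4)) <|
  .seq (.store (cellExpr 3 (.reg 4)) (.add (.reg 5) (.const 2))) <|
  .seq (.assign 5 (.add (.reg 5) (.const 1))) <|
  .seq (.assign 6 (.const 0)) <| .seq (.assign 7 (.const 1)) (.assign 8 (.const 0))

def augmentCmd : Cmd := .seq (.assign 9 (.reg 2)) (.seq augmentLoop restartCmd)

/-- The sum of two tests acts as a disjunction. Augmentation waits until the queue is exhausted,
even if `t` was reached earlier; this costs only linear time per search. -/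
def searchLoop : Cmd :=
  .loop (.add (.lt (.reg 6) (.reg 7)) (.eq (markExpr (.reg 2)) currentMark)) <|
    .branch (.lt (.reg 6) (.reg 7)) scanCmd augmentCmd

/-- The vertex in register `b` is appended to the list of neighbours of that in register `a`. -/
def addNeighborCmd (a b : ℕ) : Cmd :=
  .seq (.store (cellExpr 1 (pairExpr (.load (cellExpr 2 (.reg a))) (.reg a))) (.reg b))
    (.store (cellExpr 2 (.reg a)) (.add (.load (cellExpr 2 (.reg a))) (.const 1)))

/-- Each endpoint enters the other's list, because once the edge carries flow its residual arc is
reversed. -/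
def recordCmd : Cmd :=
  .seq (.store (cellExpr 0 (pairExpr (.reg 0) (.reg 1))) (.const 1)) <|
  .seq (addNeighborCmd 0 1) (addNeighborCmd 1 0)

/-- The product of tests acts as a conjunction. Only the arc from the tail to the head of the new
edge has become residual, so this is the only possible discovery. -/
def exploreCmd : Cmd :=
  .seq (.assign 9 (.reg 0)) <| .seq (.assign 10 (.reg 1)) <|
  .branch (.mul (.eq (markExpr (.reg 9)) currentMark) (.lt (markExpr (.reg 10)) currentMark))
    visitCmd .skip

/-- Head and tail both equal 1: in the empty graph the search from `s` is already complete. -/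
def setupCmd : Cmd :=
  .seq (.assign 3 (.reg 0)) <| .seq (.assign 4 (.reg 1)) <|
  .seq (.store (cellExpr 5 (.const 0)) (.reg 4)) <|
  .seq (.store (cellExpr 3 (.reg 4)) (.const 1)) <|
  .seq (.assign 6 (.const 1)) (.assign 7 (.const 1))

/-- The incremental maximum flow algorithm. -/
def incrementalMaxFlow : Algorithm where
  setup := setupCmd
  insertEdge := .seq recordCmd (.seq exploreCmd searchLoop)
  flow := .eq (matrixExpr (.reg 0) (.reg 1)) (.const 2)
  value := .reg 5

end Program

/-! ### Commands simulate the operations on the model. -/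

section Execution

variable {n w : ℕ} {s t : Fin n} {σ : State} {S : Model n}

theorem eval_matrixExpr (hw : WideWords n w) (hS : Fits S) (h : Represents s t σ S) {i j : ℕ}
    {u v : Fin n} (hu : σ.reg i = u) (hv : σ.reg j = v) :
    (matrixExpr (.reg i) (.reg j)).eval w σ = S.M u v :=
  eval_load (hw.eval_cellExpr_pair h.size (hw.eval_vertex hu) (hw.eval_vertex hv)
    (hw.vertex_le u) v.isLt) (h.mem.matrix u v)
    (hw.lt (by have := hS.matrix u v; have := hw.two_le; nlinarith))

theorem eval_currentMark (hw : WideWords n w) (hS : Fits S) (h : Represents s t σ S) :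
    currentMark.eval w σ = S.F + 1 := by
  have := hS.value
  exact eval_add (eval_reg h.value (hw.lt (hw.le_bound (by omega)))) (hw.eval_const (by omega))
    (hw.lt (hw.le_bound (by omega)))

theorem eval_markExpr (hw : WideWords n w) (hS : Fits S) (h : Represents s t σ S) {i : ℕ}
    {u : Fin n} (hu : σ.reg i = u) : (markExpr (.reg i)).eval w σ = σ.mem (cell 3 u) :=
  eval_load (hw.eval_cellExpr_single (hw.eval_vertex hu) (by omega)) rfl
    (hw.lt (hw.le_bound (by have := h.mem.mark_le u; have := hS.value; omega)))

theorem eval_degree (hw : WideWords n w) (hS : Fits S) (h : Represents s t σ S) {i : ℕ}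
    {u : Fin n} (hu : σ.reg i = u) :
    (Expr.load (cellExpr 2 (.reg i))).eval w σ = (S.adj u).length :=
  eval_load (hw.eval_cellExpr_single (hw.eval_vertex hu) (by omega)) (h.mem.degree u)
    (hw.lt (by have := hS.degree u; omega))

theorem runs_visitCmd (hw : WideWords n w) (hS : Fits S) (h : Represents s t σ S)
    {u v : Fin n} (hu : σ.reg 9 = u) (hv : σ.reg 10 = v) :
    ∃ σ', Runs w visitCmd σ 100 σ' ∧ Represents s t σ' (S.visit u v) := by
  have hq := hS.queue
  have hF := hS.value
  refine ⟨_, Runs.mono (Runs.seq (Runs.store (hw.eval_cellExpr_single (hw.eval_vertex hv)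
      (by omega)) (eval_currentMark hw hS h)) (Runs.seq (Runs.store (x := cell 4 v) (y := u)
        (hw.eval_cellExpr_single (hw.eval_vertex hv) (by omega)) (hw.eval_vertex hu))
      (Runs.seq (Runs.store (x := cell 5 S.queue.length) (y := v)
        (hw.eval_cellExpr_single (eval_reg h.tail (hw.lt (hw.le_bound (by omega)))) (by omega))
        (hw.eval_vertex hv))
      (Runs.assign (x := S.queue.length + 1) (eval_add (eval_reg h.tail
        (hw.lt (hw.le_bound (by omega)))) (hw.eval_const (by omega))
        (hw.lt (hw.le_bound (by omega)))))))) (by decide), ?_⟩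
  exact ⟨h.mem.visit u v, h.sink, h.size, h.source, h.value, h.head, by simp [Model.visit],
    h.position⟩

theorem runs_pushCmd (hw : WideWords n w) (hS : Fits S) (h : Represents s t σ S)
    {u v : Fin n} (hu : σ.reg 10 = u) (hv : σ.reg 9 = v) :
    ∃ σ', Runs w pushCmd σ 100 σ' ∧ Represents s t σ' (S.setMatrix (push S.M u v)) ∧
      σ'.reg = σ.reg := by
  have hM := eval_eq hw.one_lt (eval_matrixExpr hw hS h hu hv)
    (hw.eval_const (k := 1) (by omega))
  by_cases h₁ : S.M u v = 1
  · refine ⟨_, Runs.mono (Runs.branch_true (by rw [hM]; simp [h₁]) (Runs.store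
      (hw.eval_cellExpr_pair h.size (hw.eval_vertex hu) (hw.eval_vertex hv)
        (hw.vertex_le u) v.isLt) (hw.eval_const (by omega)))) (by decide), ?_, rfl⟩
    have := h.mem.setMatrix u v 2
    refine ⟨?_, h.sink, h.size, h.source, h.value, h.head, h.tail, h.position⟩
    simpa [push, h₁] using this
  · refine ⟨_, Runs.mono (Runs.branch_false (by rw [hM]; simp [h₁]) (Runs.store
      (hw.eval_cellExpr_pair h.size (hw.eval_vertex hv) (hw.eval_vertex hu)
        (hw.vertex_le v) u.isLt) (hw.eval_const (by omega)))) (by decide), ?_, rfl⟩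
    have := h.mem.setMatrix v u 1
    refine ⟨?_, h.sink, h.size, h.source, h.value, h.head, h.tail, h.position⟩
    simpa [push, h₁] using this

theorem runs_scanCmd (hw : WideWords n w) (hS : Fits S) (h : Represents s t σ S)
    (hh : S.head < S.queue.length) :
    ∃ σ' S', Runs w scanCmd σ 300 σ' ∧ Represents s t σ' S' ∧
      (((S.adj S.queue[S.head]).length ≤ S.i ∧ S' = S.nextVertex) ∨
        ∃ hi : S.i < (S.adj S.queue[S.head]).length,
          ((S.adj S.queue[S.head])[S.i] ∉ S.queue ∧
            Residual S.M S.queue[S.head] (S.adj S.queue[S.head])[S.i] ∧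
            S' = S.advance.visit S.queue[S.head] (S.adj S.queue[S.head])[S.i]) ∨
          (((S.adj S.queue[S.head])[S.i] ∈ S.queue ∨
            ¬ Residual S.M S.queue[S.head] (S.adj S.queue[S.head])[S.i]) ∧ S' = S.advance)) := by
  have hq := hS.queue
  have hhead := hS.head
  have hpos := hS.position
  have hn := hw.two_le
  set u := S.queue[S.head] with hu
  have r₁ : Runs w (.assign 9 (.load (cellExpr 5 (.reg 6)))) σ _ (σ.setReg 9 u) :=
    Runs.assign (eval_load (hw.eval_cellExpr_single (eval_reg h.head
      (hw.lt (hw.le_bound (by omega)))) (by omega)) (h.mem.queue _ hh)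
      (hw.lt (hw.le_bound (by omega))))
  have h₁ : Represents s t (σ.setReg 9 u) S := h.setReg _ (by omega)
  have hlt := eval_lt hw.one_lt (eval_reg h₁.position (hw.lt (by omega)))
    (eval_degree hw hS h₁ (i := 9) (u := u) (by simp))
  by_cases hi : S.i < (S.adj u).length
  · have hdeg := hS.degree u
    set x := (S.adj u)[S.i] with hx
    have r₂ : Runs w (.assign 10 (.load (cellExpr 1 (pairExpr (.reg 8) (.reg 9)))))
        (σ.setReg 9 u) _ ((σ.setReg 9 u).setReg 10 x) :=
      Runs.assign (eval_load (hw.eval_cellExpr_pair h₁.size (eval_reg h₁.position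
        (hw.lt (by omega))) (hw.eval_vertex (v := u) (by simp)) hpos u.isLt)
        (h₁.mem.neighbor u S.i hi) (hw.lt (hw.le_bound (by omega))))
    have h₂ : Represents s t ((σ.setReg 9 u).setReg 10 x) S := h₁.setReg _ (by omega)
    set σ₂ := (σ.setReg 9 u).setReg 10 x with hσ₂
    have r₃ : Runs w (.assign 8 (.add (.reg 8) (.const 1))) σ₂ _ (σ₂.setReg 8 (S.i + 1)) :=
      Runs.assign (eval_add (eval_reg h₂.position (hw.lt (by omega))) (hw.eval_const (by omega))
        (hw.lt (by omega)))
    have h₃ : Represents s t (σ₂.setReg 8 (S.i + 1)) S.advance :=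
      ⟨⟨h₂.mem.matrix, h₂.mem.neighbor, h₂.mem.degree, h₂.mem.mark_le, h₂.mem.mark,
        h₂.mem.parent, h₂.mem.queue⟩, h₂.sink, h₂.size, h₂.source, h₂.value, h₂.head, h₂.tail,
        by simp [Model.advance]⟩
    have hS₃ : Fits S.advance := ⟨hS.matrix, hS.degree, hS.queue, hS.head, by
      simp only [Model.advance]; omega, hS.value⟩
    set σ₃ := σ₂.setReg 8 (S.i + 1) with hσ₃
    have e₉ : σ₃.reg 9 = u := by simp [hσ₃, hσ₂]
    have e₁₀ : σ₃.reg 10 = x := by simp [hσ₃, hσ₂]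
    have ev₁ := eval_lt hw.one_lt (eval_markExpr hw hS₃ h₃ e₁₀) (eval_currentMark hw hS₃ h₃)
    have ev₂ := eval_eq hw.one_lt (eval_matrixExpr hw hS₃ h₃ e₉ e₁₀)
      (hw.eval_const (k := 1) (by omega))
    have ev₃ := eval_eq hw.one_lt (eval_matrixExpr hw hS₃ h₃ e₁₀ e₉)
      (hw.eval_const (k := 2) (by omega))
    -- With antiparallel edges both residual tests may succeed, so their sum can be 2.
    have small : ∀ k ≤ 2, k < 2 ^ w := fun k hk => hw.lt (hw.le_bound (by omega))
    have ev₄ := eval_add ev₂ ev₃ (small _ (by split_ifs <;> omega))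
    have ev₅ := eval_mul ev₁ ev₄ (small _ (by split_ifs <;> omega))
    have hmark := h₃.mem.mark x
    have hmark_le := h₃.mem.mark_le x
    by_cases hv : x ∉ S.queue ∧ Residual S.M u x
    · obtain ⟨σ', r₄, h₄⟩ := runs_visitCmd hw hS₃ h₃ e₉ e₁₀
      refine ⟨σ', _, Runs.mono (Runs.seq r₁ (Runs.branch_true (by rw [hlt]; simp [hi])
        (Runs.seq r₂ (Runs.seq r₃ (Runs.branch_true ?_ r₄))))) (by decide), h₄,
        Or.inr ⟨hi, Or.inl ⟨hv.1, hv.2, rfl⟩⟩⟩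
      rw [ev₅]
      have h₅ : σ₃.mem (cell 3 x) < S.advance.F + 1 :=
        lt_of_le_of_ne hmark_le fun hc => hv.1 (hmark.1 hc)
      rw [if_pos h₅]
      rcases hv.2 with h₆ | h₆ <;> simp [Model.advance, h₆]
    · refine ⟨σ₃, _, Runs.mono (Runs.seq r₁ (Runs.branch_true (by rw [hlt]; simp [hi])
        (Runs.seq r₂ (Runs.seq r₃ (Runs.branch_false ?_ Runs.skip))))) (by decide), h₃,
        Or.inr ⟨hi, Or.inr ⟨by tauto, rfl⟩⟩⟩
      rw [ev₅]
      by_cases hxq : x ∈ S.queue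
      · rw [if_neg (by rw [hmark.2 hxq]; omega), zero_mul]
      · have h₆ : ¬ Residual S.M u x := fun hc => hv ⟨hxq, hc⟩
        simp only [Residual, not_or] at h₆
        simp [Model.advance, h₆.1, h₆.2]
  · refine ⟨_, _, Runs.mono (Runs.seq r₁ (Runs.branch_false (by rw [hlt]; simp [hi])
      (Runs.seq (Runs.assign (x := S.head + 1) (eval_add (eval_reg h₁.head
        (hw.lt (hw.le_bound (by omega)))) (hw.eval_const (by omega))
        (hw.lt (hw.le_bound (by omega)))))
        (Runs.assign (hw.eval_const (k := 0) (by omega)))))) (by decide), ?_,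
      Or.inl ⟨by omega, rfl⟩⟩
    exact ⟨⟨h.mem.matrix, h.mem.neighbor, h.mem.degree, h.mem.mark_le, h.mem.mark,
        h.mem.parent, h.mem.queue⟩, h.sink, h.size, h.source, h.value, by simp [Model.nextVertex],
        h.tail, by simp [Model.nextVertex]⟩

theorem runs_restartCmd (hw : WideWords n w) (hS : Fits S) (h : Represents s t σ S) :
    ∃ σ', Runs w restartCmd σ 100 σ' ∧ Represents s t σ' (S.restart s) := by
  have hF := hS.value
  refine ⟨_, Runs.mono (Runs.seq (Runs.store (x := cell 5 0) (y := s)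
      (hw.eval_cellExpr_single (hw.eval_const (by omega)) (by omega))
      (hw.eval_vertex h.source)) (Runs.seq (Runs.store (x := cell 3 s) (y := S.F + 2)
        (hw.eval_cellExpr_single (hw.eval_vertex h.source) (by omega))
        (eval_add (eval_reg h.value (hw.lt (hw.le_bound (by omega)))) (hw.eval_const (by omega))
          (hw.lt (hw.le_bound (by omega)))))
      (Runs.seq (Runs.assign (x := S.F + 1) (eval_add (eval_reg h.value
        (hw.lt (hw.le_bound (by omega)))) (hw.eval_const (by omega))
        (hw.lt (hw.le_bound (by omega)))))
      (Runs.seq (Runs.assign (hw.eval_const (k := 0) (by omega)))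
      (Runs.seq (Runs.assign (hw.eval_const (k := 1) (by omega)))
        (Runs.assign (hw.eval_const (k := 0) (by omega)))))))) (by decide), ?_⟩
  exact ⟨h.mem.restart s, h.sink, h.size, h.source, by simp [Model.restart],
    by simp [Model.restart], by simp [Model.restart], by simp [Model.restart]⟩

theorem runs_addNeighborCmd (hw : WideWords n w) (hS : Fits S) (h : Represents s t σ S)
    {a b : ℕ} {u v : Fin n} (hu : σ.reg a = u) (hv : σ.reg b = v) :
    ∃ σ', Runs w (addNeighborCmd a b) σ 100 σ' ∧ Represents s t σ' (S.addNeighbor u v) ∧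
      σ'.reg = σ.reg := by
  have hd := hS.degree u
  refine ⟨_, Runs.mono (Runs.seq (Runs.store (hw.eval_cellExpr_pair h.size
    (eval_degree hw hS h hu) (hw.eval_vertex hu) hd u.isLt) (hw.eval_vertex hv))
    (Runs.store (x := cell 2 u) (y := (S.adj u).length + 1)
      (hw.eval_cellExpr_single (hw.eval_vertex hu) (by omega))
      (eval_add (eval_load (hw.eval_cellExpr_single (hw.eval_vertex hu) (by omega))
        (by simpa [Function.update_apply] using h.mem.degree u) (hw.lt (by omega)))
        (hw.eval_const (by omega)) (hw.lt (by omega))))) (by simp [Expr.cost, cellExpr, pairExpr]), ?_, rfl⟩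
  exact ⟨h.mem.addNeighbor u v, h.sink, h.size, h.source, h.value, h.head, h.tail, h.position⟩

end Execution

/-! ### Invariants of the search and the potential. -/

section Invariant

variable {n : ℕ} {s t : Fin n} {L : List (Fin n × Fin n)} {S : Model n}

/-- The model consists of a flow in the graph with edge list `L`, the lists of neighbours, and a
search tree of the residual graph that is rooted at the source. -/
structure Consistent (s t : Fin n) (L : List (Fin n × Fin n)) (S : Model n) : Prop where
  encodes : Encodes s t L S.M S.F
  mem_adj : ∀ u v, (u, v) ∈ L → v ∈ S.adj u ∧ u ∈ S.adj v
  sum_adj : ∑ u, (S.adj u).length = 2 * L.length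
  nodup : S.queue.Nodup
  source_mem : s ∈ S.queue
  tree : ∀ v ∈ S.queue, v ≠ s → S.par v ∈ S.queue ∧
    S.queue.idxOf (S.par v) < S.queue.idxOf v ∧ Residual S.M (S.par v) v
  head_le : S.head ≤ S.queue.length
  position_le : ∀ h : S.head < S.queue.length, S.i ≤ (S.adj S.queue[S.head]).length
  position_eq : S.head = S.queue.length → S.i = 0

/-- The search has followed all residual arcs that it has passed. -/
structure Scanned (S : Model n) : Prop where
  passed : ∀ v ∈ S.queue.take S.head, ∀ x, Residual S.M v x → x ∈ S.queue
  current : ∀ h : S.head < S.queue.length, ∀ x ∈ (S.adj S.queue[S.head]).take S.i,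
    Residual S.M S.queue[S.head] x → x ∈ S.queue

/-- A residual arc lies over an edge in one of the two directions, and edges are listed at both
ends. The first half makes scanning lists sufficient; the second gives every head of a residual arc
positive degree. -/
theorem Consistent.residual_adj (h : Consistent s t L S) {u v : Fin n} (hr : Residual S.M u v) :
    v ∈ S.adj u ∧ u ∈ S.adj v := by
  rcases hr with hr | hr
  · exact h.mem_adj u v (not_not.1 ((h.encodes.eq_zero u v).not.1 (by omega)))
  · exact (h.mem_adj v u (not_not.1 ((h.encodes.eq_zero v u).not.1 (by omega)))).symm

/-- Distinct edges number at most `n ^ 2`, and one degree is at most the degree sum, twice the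
number of edges. -/
theorem Consistent.fits (h : Consistent s t L S) (hL : L.Nodup) (hne : ∀ e ∈ L, e.1 ≠ e.2) :
    Fits S := by
  have hm : L.length ≤ n ^ 2 := by
    have := hL.length_le_card
    simpa [sq] using this
  have hdeg : ∀ u, (S.adj u).length ≤ 2 * n ^ 2 := fun u => by
    have h₁ := Finset.single_le_sum (f := fun u => (S.adj u).length)
      (fun _ _ => Nat.zero_le _) (Finset.mem_univ u)
    have h₂ := h.sum_adj
    omega
  have hq : S.queue.length ≤ n := by simpa using h.nodup.length_le_card
  refine ⟨h.encodes.le_two, hdeg, hq, h.head_le.trans hq, ?_, h.encodes.value_lt hne⟩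
  rcases h.head_le.lt_or_eq with hh | hh
  · exact (h.position_le hh).trans (hdeg _)
  · simp [h.position_eq hh]

theorem Consistent.visit (h : Consistent s t L S) {u x : Fin n} (hu : u ∈ S.queue)
    (hx : x ∉ S.queue) (hr : Residual S.M u x) : Consistent s t L (S.visit u x) where
  encodes := h.encodes
  mem_adj := h.mem_adj
  sum_adj := h.sum_adj
  nodup := by
    simp only [Model.visit]
    exact List.nodup_append.2 ⟨h.nodup, List.nodup_singleton x, by
      rintro a ha b hb rfl
      exact hx (List.mem_singleton.1 hb ▸ ha)⟩
  source_mem := List.mem_append_left _ h.source_mem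
  tree v hv hvs := by
    simp only [Model.visit] at hv ⊢
    by_cases hvx : v = x
    · subst hvx
      rw [Function.update_self, List.idxOf_append_of_mem hu, List.idxOf_append_of_notMem hx]
      exact ⟨List.mem_append_left _ hu, by have := List.idxOf_lt_length_iff.2 hu; omega, hr⟩
    · have hv' : v ∈ S.queue := by simpa [hvx] using hv
      obtain ⟨h₁, h₂, h₃⟩ := h.tree v hv' hvs
      rw [Function.update_of_ne hvx, List.idxOf_append_of_mem h₁, List.idxOf_append_of_mem hv']
      exact ⟨List.mem_append_left _ h₁, h₂, h₃⟩
  head_le := by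
    have := h.head_le
    simp only [Model.visit, List.length_append]
    omega
  position_le hh := by
    simp only [Model.visit]
    rcases h.head_le.lt_or_eq with hh' | hh'
    · rw [List.getElem_append_left hh']
      exact h.position_le hh'
    -- The search was finished, so the new vertex becomes the current one, with no neighbour
    -- examined.
    · simp [h.position_eq hh']
  position_eq hh := by
    have := h.head_le
    simp only [Model.visit, List.length_append, List.length_singleton] at hh
    omega

theorem Scanned.visit (h : Scanned S) (hle : S.head ≤ S.queue.length)
    (h₀ : S.head = S.queue.length → S.i = 0) (u x : Fin n) : Scanned (S.visit u x) where
  passed v hv y hr := by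
    simp only [Model.visit, List.take_append_of_le_length hle] at hv
    exact List.mem_append_left _ (h.passed v hv y hr)
  current hh y hy hr := by
    simp only [Model.visit] at hy hr ⊢
    rcases hle.lt_or_eq with hh' | hh'
    · rw [List.getElem_append_left hh'] at hy hr
      exact List.mem_append_left _ (h.current hh' y hy hr)
    · simp [h₀ hh'] at hy

theorem Consistent.advance (h : Consistent s t L S) (hh : S.head < S.queue.length)
    (hi : S.i < (S.adj S.queue[S.head]).length) : Consistent s t L S.advance :=
  { h with
    position_le := fun _ => hi
    position_eq := fun hc => absurd hc hh.ne }

theorem Scanned.advance (h : Scanned S) (hh : S.head < S.queue.length)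
    (hi : S.i < (S.adj S.queue[S.head]).length)
    (hx : Residual S.M S.queue[S.head] (S.adj S.queue[S.head])[S.i] →
      (S.adj S.queue[S.head])[S.i] ∈ S.queue) : Scanned S.advance where
  passed := h.passed
  current hh' x hx' hr := by
    simp only [Model.advance] at hx' hr ⊢
    rw [← List.take_concat_get' _ _ hi, List.mem_append, List.mem_singleton] at hx'
    rcases hx' with hx' | rfl
    · exact h.current hh x hx' hr
    · exact hx hr

theorem Consistent.nextVertex (h : Consistent s t L S) (hh : S.head < S.queue.length) :
    Consistent s t L S.nextVertex :=
  { h with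
    head_le := hh
    position_le := fun _ => Nat.zero_le _
    position_eq := fun _ => rfl }

theorem Consistent.scanned_nextVertex (h : Consistent s t L S) (hS : Scanned S)
    (hh : S.head < S.queue.length) (hi : (S.adj S.queue[S.head]).length ≤ S.i) :
    Scanned S.nextVertex where
  passed v hv x hr := by
    simp only [Model.nextVertex] at hv hr ⊢
    rw [← List.take_concat_get' _ _ hh, List.mem_append, List.mem_singleton] at hv
    rcases hv with hv | rfl
    · exact hS.passed v hv x hr
    · refine hS.current hh x ?_ hr
      rw [List.take_of_length_le hi]
      exact (h.residual_adj hr).1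
  current _ x hx := by simp [Model.nextVertex] at hx

/-- The number of steps of the current search. -/
def Model.work (S : Model n) : ℕ :=
  ((S.queue.take S.head).map fun v => (S.adj v).length + 1).sum + S.i

theorem Consistent.sum_queue_le (h : Consistent s t L S) :
    (S.queue.map fun v => (S.adj v).length).sum ≤ 2 * L.length := by
  rw [← List.sum_toFinset _ h.nodup, ← h.sum_adj]
  exact Finset.sum_le_sum_of_subset (Finset.subset_univ _)

/-- Every reached vertex except `s` is the head of a residual tree arc and so has degree at least
one; such vertices are bounded by the degree sum. -/
theorem Consistent.length_queue_le (h : Consistent s t L S) :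
    S.queue.length ≤ 2 * L.length + 1 := by
  have h₁ : (S.queue.toFinset.erase s).card ≤ 2 * L.length := by
    rw [← h.sum_adj, Finset.card_eq_sum_ones]
    refine le_trans (Finset.sum_le_sum fun v hv => ?_)
      (Finset.sum_le_sum_of_subset (Finset.subset_univ _))
    rw [Finset.mem_erase, List.mem_toFinset] at hv
    exact List.length_pos_of_mem (h.residual_adj (h.tree v hv.2 hv.1).2.2).2
  rw [Finset.card_erase_of_mem (List.mem_toFinset.2 h.source_mem),
    List.toFinset_card_of_nodup h.nodup] at h₁
  omega

/-- Degrees contribute at most `2 * m` and the ones per vertex at most `2 * m + 1`. The position `i`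
is covered by the degree of the current vertex. -/
theorem Consistent.work_le (h : Consistent s t L S) : S.work ≤ 4 * L.length + 1 := by
  have h₁ := h.sum_queue_le
  have h₂ := h.length_queue_le
  have h₃ : (S.queue.map fun v => (S.adj v).length + 1).sum ≤ 4 * L.length + 1 := by
    rw [List.sum_map_add]
    simp only [List.map_const', List.sum_replicate, smul_eq_mul, mul_one]
    omega
  refine le_trans ?_ h₃
  unfold Model.work
  rcases h.head_le.lt_or_eq with hh | hh
  · conv_rhs => rw [← List.take_append_drop S.head S.queue, List.drop_eq_getElem_cons hh]
    have := h.position_le hh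
    simp only [List.map_append, List.sum_append, List.map_cons, List.sum_cons]
    omega
  · rw [h.position_eq hh, hh, List.take_length, add_zero]

theorem work_visit (hle : S.head ≤ S.queue.length) (u x : Fin n) :
    (S.visit u x).work = S.work := by
  simp only [Model.work, Model.visit, List.take_append_of_le_length hle]

theorem work_advance : S.advance.work = S.work + 1 := by
  simp only [Model.work, Model.advance]
  omega

theorem Consistent.work_nextVertex (h : Consistent s t L S) (hh : S.head < S.queue.length)
    (hi : (S.adj S.queue[S.head]).length ≤ S.i) : S.nextVertex.work = S.work + 1 := by
  have := h.position_le hh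
  simp only [Model.work, Model.nextVertex]
  rw [← List.take_concat_get' _ _ hh]
  simp only [List.map_append, List.sum_append, List.map_cons, List.sum_cons, List.map_nil,
    List.sum_nil]
  omega

theorem Encodes.augment {M M' : Fin n → Fin n → ℕ} {F : ℕ} (h : Encodes s t L M F) (hst : s ≠ t)
    (h₂ : ∀ u v, M' u v ≤ 2) (h₀ : ∀ u v, M' u v = 0 ↔ M u v = 0)
    (hn : ∀ v, netFlow M' v =
      netFlow M v + (if v = s then 1 else 0) - (if v = t then 1 else 0)) :
    Encodes s t L M' (F + 1) where
  le_two := h₂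
  eq_zero u v := (h₀ u v).trans (h.eq_zero u v)
  conservation v hs ht := by rw [hn, h.conservation v hs ht]; simp [hs, ht]
  value := by rw [hn, h.value]; simp [hst]

theorem Consistent.restart (h : Consistent s t L S) {M : Fin n → Fin n → ℕ}
    (hM : Encodes s t L M (S.F + 1)) : Consistent s t L ((S.setMatrix M).restart s) where
  encodes := hM
  mem_adj := h.mem_adj
  sum_adj := h.sum_adj
  nodup := List.nodup_singleton s
  source_mem := List.mem_singleton_self s
  tree _ hv hvs := absurd (List.mem_singleton.1 hv) hvs
  head_le := Nat.zero_le _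
  position_le _ := Nat.zero_le _
  position_eq _ := rfl

theorem scanned_restart (S : Model n) (s : Fin n) : Scanned (S.restart s) where
  passed _ hv := by simp [Model.restart] at hv
  current _ _ hx := by simp [Model.restart] at hx

def Model.record (S : Model n) (u v : Fin n) : Model n :=
  ((S.setMatrix (setEntry S.M u v 1)).addNeighbor u v).addNeighbor v u

theorem length_addNeighbor (S : Model n) (u v a : Fin n) :
    ((S.addNeighbor u v).adj a).length = (S.adj a).length + if a = u then 1 else 0 := by
  by_cases h : a = u
  · subst h; simp [Model.addNeighbor]
  · simp [Model.addNeighbor, h]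

theorem mem_addNeighbor (S : Model n) (u v a b : Fin n) :
    b ∈ (S.addNeighbor u v).adj a ↔ b ∈ S.adj a ∨ a = u ∧ b = v := by
  by_cases h : a = u
  · subst h; simp [Model.addNeighbor]
  · simp [Model.addNeighbor, h]

/-- The entry rises from 0 to 1: it had produced no residual arc, and without flow it produces none
backwards. -/
theorem residual_setEntry {M : Fin n → Fin n → ℕ} {u v : Fin n} (h : M u v = 0) (a b : Fin n) :
    Residual (setEntry M u v 1) a b ↔ Residual M a b ∨ a = u ∧ b = v := by
  unfold Residual setEntry
  by_cases h₁ : a = u ∧ b = v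
  · simp [h₁]
  · by_cases h₂ : b = u ∧ a = v
    · obtain ⟨rfl, rfl⟩ := h₂
      simp [h₁, h]
    · simp [h₁, h₂]

/-- Tree arcs stay residual, and a finished search has no current vertex whose position could be
disturbed by the longer lists. -/
theorem Consistent.record (h : Consistent s t L S) (hh : S.head = S.queue.length) {u v : Fin n}
    (huv : (u, v) ∉ L) : Consistent s t (L ++ [(u, v)]) (S.record u v) where
  encodes := by
    have h₀ := (h.encodes.eq_zero u v).2 huv
    have hnet : ∀ a, netFlow (setEntry S.M u v 1) a = netFlow S.M a := fun a => by
      simp [netFlow_setEntry, unitFlow, h₀]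
    refine ⟨fun a b => ?_, fun a b => ?_, fun a has hat => ?_, ?_⟩
    · simp only [Model.record, Model.addNeighbor, Model.setMatrix, setEntry]
      split_ifs
      · omega
      · exact h.encodes.le_two a b
    · simp only [Model.record, Model.addNeighbor, Model.setMatrix, setEntry]
      by_cases hab : a = u ∧ b = v
      · simp [hab]
      · have := h.encodes.eq_zero a b
        simp [hab, this]
    · exact (hnet a).trans (h.encodes.conservation a has hat)
    · exact (hnet s).trans h.encodes.value
  mem_adj a b hab := by
    simp only [Model.record, mem_addNeighbor]
    rw [List.mem_append, List.mem_singleton, Prod.mk_inj] at hab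
    rcases hab with hab | ⟨rfl, rfl⟩
    · have := h.mem_adj a b hab
      exact ⟨Or.inl (Or.inl this.1), Or.inl (Or.inl this.2)⟩
    · simp
  sum_adj := by
    have := h.sum_adj
    simp only [Model.record, length_addNeighbor, Finset.sum_add_distrib]
    simp only [Model.setMatrix, this, Finset.sum_ite_eq', Finset.mem_univ, if_true,
      List.length_append, List.length_singleton]
    ring
  nodup := h.nodup
  source_mem := h.source_mem
  tree x hx hxs := by
    obtain ⟨h₁, h₂, h₃⟩ := h.tree x hx hxs
    exact ⟨h₁, h₂, (residual_setEntry ((h.encodes.eq_zero u v).2 huv) _ _).2 (Or.inl h₃)⟩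
  head_le := h.head_le
  position_le hc := absurd hh hc.ne
  position_eq := h.position_eq

theorem Consistent.scanned_record (h : Consistent s t L S) (hS : Scanned S)
    (hh : S.head = S.queue.length) {u v : Fin n} (huv : (u, v) ∉ L)
    (hv : u ∈ S.queue → v ∈ S.queue) : Scanned (S.record u v) where
  passed a ha x hr := by
    rcases (residual_setEntry ((h.encodes.eq_zero u v).2 huv) _ _).1 hr with hr | ⟨rfl, rfl⟩
    · exact hS.passed a ha x hr
    · exact hv (List.mem_of_mem_take ha)
  current hc := absurd hh hc.ne

/-- The one new residual arc ends in the vertex just appended. Since the old search was finished,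
that vertex is unscanned and `i = 0`. -/
theorem Consistent.scanned_record_visit (h : Consistent s t L S) (hS : Scanned S)
    (hh : S.head = S.queue.length) {u v : Fin n} (huv : (u, v) ∉ L) :
    Scanned ((S.record u v).visit u v) where
  passed a ha x hr := by
    have ha' : a ∈ S.queue.take S.head := by
      simpa only [Model.visit, Model.record, Model.addNeighbor, Model.setMatrix,
        List.take_append_of_le_length h.head_le] using ha
    rcases (residual_setEntry ((h.encodes.eq_zero u v).2 huv) _ _).1 hr with hr | ⟨rfl, rfl⟩
    · exact List.mem_append_left _ (hS.passed a ha' x hr)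
    · exact List.mem_append_right _ (List.mem_singleton_self x)
  current _ x hx := by
    have h₀ : ((S.record u v).visit u v).i = 0 := h.position_eq hh
    rw [h₀, List.take_zero] at hx
    simp at hx

theorem work_record_ge (S : Model n) (u v : Fin n) : S.work ≤ (S.record u v).work := by
  have : ∀ a, (S.adj a).length ≤ ((S.record u v).adj a).length := fun a => by
    simp only [Model.record, length_addNeighbor, Model.setMatrix]
    omega
  unfold Model.work
  exact Nat.add_le_add (List.sum_le_sum fun a _ => Nat.add_le_add_right (this a) 1) le_rfl

/-- A bound for the number of steps so far, up to a constant factor. -/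
def Model.potential (m : ℕ) (S : Model n) : ℕ := m + S.F * (6 * m + 4) + S.work

/-- With `m ≥ 1`, the term with `F` is at most `10 * m * F` and the rest, `5 * m + 1`, at most `6 *
m`. -/
theorem Consistent.potential_le (h : Consistent s t L S) (hL : L ≠ []) :
    S.potential L.length ≤ 16 * (L.length * max S.F 1) := by
  have h₁ := h.work_le
  have h₂ : 0 < L.length := List.length_pos_of_ne_nil hL
  have h₃ : L.length * S.F ≤ L.length * max S.F 1 := Nat.mul_le_mul_left _ (le_max_left _ _)
  have h₄ : L.length * 1 ≤ L.length * max S.F 1 := Nat.mul_le_mul_left _ (le_max_right _ _)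
  have h₅ : S.F * (6 * L.length + 4) ≤ 10 * (L.length * S.F) := by nlinarith
  unfold Model.potential
  omega

theorem Consistent.isMaxFlow (h : Consistent s t L S) (hS : Scanned S)
    (hh : S.head = S.queue.length) (ht : t ∉ S.queue) :
    IsMaxFlow {e | e ∈ L} s t (fun u v => (unitFlow S.M u v : ℝ)) := by
  refine h.encodes.isMaxFlow S.queue.toFinset (by simpa using h.source_mem) (by simpa using ht)
    fun u hu v hr => ?_
  rw [List.mem_toFinset] at hu ⊢
  exact hS.passed u (by rwa [hh, List.take_length]) v hr

end Invariant

/-! ### Augmentation, amortized cost and correctness. -/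

section Correctness

variable {n w : ℕ} {s t : Fin n}

/-- Induction along the tree path towards `s`, measured by the position in the queue. Pushes destroy
residual tree arcs behind the walk, so residuality is required only up to the position of `x`; the
unit sent so far appears as the imbalance at `x`. -/
theorem runs_augmentLoop (hw : WideWords n w) (N : ℕ) : ∀ (σ : State) (S : Model n) (x : Fin n),
    Fits S → Represents s t σ S → σ.reg 9 = x → x ∈ S.queue → S.queue.idxOf x ≤ N →
    (∀ v ∈ S.queue, v ≠ s → S.par v ∈ S.queue ∧ S.queue.idxOf (S.par v) < S.queue.idxOf v) →
    (∀ v ∈ S.queue, v ≠ s → S.queue.idxOf v ≤ S.queue.idxOf x → Residual S.M (S.par v) v) →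
    ∃ σ' M', Runs w augmentLoop σ (300 * (N + 1)) σ' ∧ Represents s t σ' (S.setMatrix M') ∧
      (∀ u v, M' u v ≤ 2) ∧ (∀ u v, M' u v = 0 ↔ S.M u v = 0) ∧
      ∀ v, netFlow M' v =
        netFlow S.M v + (if v = s then 1 else 0) - (if v = x then 1 else 0) := by
  induction N with
  | zero =>
    intro σ S x hS h hx hxq hN htree _
    -- A vertex other than `s` has a parent at a strictly smaller position.
    have hxs : x = s := by
      by_contra hxs
      have := (htree x hxq hxs).2
      omega
    subst hxs
    refine ⟨σ, S.M, Runs.mono (Runs.loop_false ?_) (by decide), h, hS.matrix,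
      fun _ _ => Iff.rfl, fun v => by ring⟩
    rw [eval_sub (hw.eval_const (by omega))
      (eval_eq hw.one_lt (hw.eval_vertex hx) (hw.eval_vertex h.source))]
    simp
  | succ N ih =>
    intro σ S x hS h hx hxq hN htree hres
    have hcond := eval_sub (hw.eval_const (k := 1) (by omega))
      (eval_eq hw.one_lt (hw.eval_vertex hx) (hw.eval_vertex h.source))
    by_cases hxs : x = s
    · subst hxs
      refine ⟨σ, S.M, Runs.mono (Runs.loop_false (by rw [hcond]; simp))
        (by simp only [Expr.cost]; omega), h, hS.matrix, fun _ _ => Iff.rfl, fun v => by ring⟩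
    · obtain ⟨hy, hlt⟩ := htree x hxq hxs
      have hr := hres x hxq hxs le_rfl
      set y := S.par x with hy'
      have r₁ : Runs w (.assign 10 (.load (cellExpr 4 (.reg 9)))) σ _ (σ.setReg 10 y) :=
        Runs.assign (eval_load (hw.eval_cellExpr_single (hw.eval_vertex hx) (by omega))
          (h.mem.parent x) (hw.lt (hw.le_bound (by omega))))
      have h₁ : Represents s t (σ.setReg 10 y) S := h.setReg _ (by omega)
      obtain ⟨σ₂, r₂, h₂, e₂⟩ := runs_pushCmd hw hS h₁ (u := y) (v := x) (by simp) (by simp [hx])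
      have r₃ : Runs w (.assign 9 (.reg 10)) σ₂ _ (σ₂.setReg 9 y) :=
        Runs.assign (hw.eval_vertex (by simp [e₂]))
      have h₃ : Represents s t (σ₂.setReg 9 y) (S.setMatrix (push S.M y x)) :=
        h₂.setReg _ (by omega)
      have hS₃ : Fits (S.setMatrix (push S.M y x)) :=
        ⟨push_le_two hS.matrix y x, hS.degree, hS.queue, hS.head, hS.position, hS.value⟩
      obtain ⟨σ', M', r₄, h₄, hM', hz, hn⟩ := ih _ _ y hS₃ h₃ (by simp) hy
        (by simp only [Model.setMatrix]; omega) htree (fun v hv hvs hle => by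
          have hle' : S.queue.idxOf v ≤ S.queue.idxOf y := hle
          have hp := (htree v hv hvs).2
          -- Vertices no later than `y` in the queue, and their parents, precede `x`; the push
          -- leaves the arcs between them untouched.
          have hvx : v ≠ x := fun hc => by subst hc; omega
          have hpx : S.par v ≠ x := fun hc => by rw [hc] at hp; omega
          have := hres v hv hvs (by omega)
          simpa only [Residual, Model.setMatrix, push_of_ne hvx hpx, push_of_ne hpx hvx]
            using this)
      refine ⟨σ', M', Runs.mono (Runs.loop_true (by rw [hcond]; simp [Fin.val_inj, hxs])
        (Runs.seq r₁ (Runs.seq r₂ r₃)) r₄) (by simp only [Expr.cost, cellExpr]; omega), h₄, hM',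
        fun u v => (hz u v).trans (push_eq_zero hr u v), fun v => ?_⟩
      rw [hn]
      simp only [Model.setMatrix]
      rw [netFlow_push hr]
      ring

/-- The machine state `σ` represents a model of the graph with edge list `L`. -/
structure Maintains (s t : Fin n) (L : List (Fin n × Fin n)) (σ : State) (S : Model n) :
    Prop where
  represents : Represents s t σ S
  consistent : Consistent s t L S
  scanned : Scanned S

variable {L : List (Fin n × Fin n)}

/-- The gain `6 * m + 4` minus the lost work `4 * m + 1` leaves at least `2 * m + 3`, which at 1000
steps per unit covers `300 * (2 * m + 1)` steps for the path and constant overhead. The spare 100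
pays for the surrounding tests. -/
theorem Maintains.augment (hw : WideWords n w) (hst : s ≠ t) (hL : L.Nodup)
    (hne : ∀ e ∈ L, e.1 ≠ e.2) {σ : State} {S : Model n} (h : Maintains s t L σ S)
    (ht : t ∈ S.queue) :
    ∃ σ' S' K, Runs w augmentCmd σ K σ' ∧ Maintains s t L σ' S' ∧
      K + 100 + 1000 * S.potential L.length ≤ 1000 * S'.potential L.length := by
  have hS := h.consistent.fits hL hne
  have hr := h.represents
  have r₁ : Runs w (.assign 9 (.reg 2)) σ _ (σ.setReg 9 t) :=
    Runs.assign (hw.eval_vertex hr.sink)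
  have h₁ : Represents s t (σ.setReg 9 t) S := hr.setReg _ (by omega)
  obtain ⟨σ₂, M', r₂, h₂, hM, hz, hn⟩ := runs_augmentLoop hw (2 * L.length) _ S t hS h₁
    (by simp) ht (by
      have := List.idxOf_lt_length_iff.2 ht
      have := h.consistent.length_queue_le
      omega) (fun v hv hvs => by
      have := h.consistent.tree v hv hvs
      exact ⟨this.1, this.2.1⟩) (fun v hv hvs _ => (h.consistent.tree v hv hvs).2.2)
  have hS₂ : Fits (S.setMatrix M') :=
    ⟨hM, hS.degree, hS.queue, hS.head, hS.position, hS.value⟩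
  obtain ⟨σ', r₃, h₃⟩ := runs_restartCmd hw hS₂ h₂
  refine ⟨σ', _, _, Runs.seq r₁ (Runs.seq r₂ r₃), ⟨h₃,
    h.consistent.restart (h.consistent.encodes.augment hst hM hz hn), scanned_restart _ _⟩, ?_⟩
  have hwk := h.consistent.work_le
  have hm : 0 < L.length := by
    by_contra hc
    have h₀ : L = [] := List.length_eq_zero_iff.1 (by omega)
    have h₁ := h.consistent.residual_adj (h.consistent.tree t ht hst.symm).2.2
    have h₂ := h.consistent.sum_adj
    have h₃ := Finset.single_le_sum (f := fun u => (S.adj u).length)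
      (fun _ _ => Nat.zero_le _) (Finset.mem_univ t)
    have h₄ := List.length_pos_of_mem h₁.2
    simp only [h₀, List.length_nil] at h₂
    omega
  simp only [Model.potential, Model.restart, Model.setMatrix, Expr.cost]
  have : (S.F + 1) * (6 * L.length + 4) = S.F * (6 * L.length + 4) + (6 * L.length + 4) := by ring
  omega

theorem Maintains.scan (hw : WideWords n w) (hL : L.Nodup)
    (hne : ∀ e ∈ L, e.1 ≠ e.2) {σ : State} {S : Model n} (h : Maintains s t L σ S)
    (hh : S.head < S.queue.length) :
    ∃ σ' S', Runs w scanCmd σ 300 σ' ∧ Maintains s t L σ' S' ∧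
      S'.potential L.length = S.potential L.length + 1 := by
  have hc := h.consistent
  obtain ⟨σ', S', hrun, hrep, hcase⟩ := runs_scanCmd hw (hc.fits hL hne) h.represents hh
  refine ⟨σ', S', hrun, ?_⟩
  rcases hcase with ⟨hi, rfl⟩ | ⟨hi, ⟨hx, hr, rfl⟩ | ⟨hx, rfl⟩⟩
  · refine ⟨⟨hrep, hc.nextVertex hh, hc.scanned_nextVertex h.scanned hh hi⟩, ?_⟩
    have := hc.work_nextVertex hh hi
    simp only [Model.potential, this, add_assoc]
    rfl
  · set u := S.queue[S.head] with hu
    set x := (S.adj u)[S.i] with hx'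
    -- Advancing and visiting commute. Visiting first means that the neighbour is already in the
    -- queue when the position passes it.
    have hcv := hc.visit (List.getElem_mem hh) hx hr
    have hsv := h.scanned.visit hc.head_le hc.position_eq u x
    have hh' : (S.visit u x).head < (S.visit u x).queue.length := by
      simp only [Model.visit, List.length_append]; omega
    have e : (S.visit u x).queue[(S.visit u x).head] = u := by
      simp only [Model.visit]; rw [List.getElem_append_left hh]
    have hi' : (S.visit u x).i <
        ((S.visit u x).adj (S.visit u x).queue[(S.visit u x).head]).length := by
      rw [e]; exact hi
    refine ⟨⟨hrep, hcv.advance hh' hi', hsv.advance hh' hi' fun _ => ?_⟩, ?_⟩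
    · have e' : ((S.visit u x).adj (S.visit u x).queue[(S.visit u x).head])[(S.visit u x).i]
          = x := by simp only [e]; rfl
      rw [e']
      simp [Model.visit]
    · have h₁ := work_visit hc.head_le u x
      have h₂ := work_advance (S := S.visit u x)
      have h₃ : (S.advance.visit u x).work = S.work + 1 := h₂.trans (by rw [h₁])
      simp only [Model.potential, ← hu, h₃, ← add_assoc]
      rfl
  · refine ⟨⟨hrep, hc.advance hh hi, h.scanned.advance hh hi fun hr => ?_⟩, ?_⟩
    · tauto
    · simp only [Model.potential, work_advance, ← add_assoc]
      rfl

theorem Maintains.searchLoop_cond (hw : WideWords n w) (hL : L.Nodup)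
    (hne : ∀ e ∈ L, e.1 ≠ e.2) {σ : State} {S : Model n} (h : Maintains s t L σ S) :
    (Expr.lt (.reg 6) (.reg 7)).eval w σ = (if S.head < S.queue.length then 1 else 0) ∧
    (Expr.add (.lt (.reg 6) (.reg 7)) (.eq (markExpr (.reg 2)) currentMark)).eval w σ =
      (if S.head < S.queue.length then 1 else 0) + (if t ∈ S.queue then 1 else 0) := by
  have hS := h.consistent.fits hL hne
  have hr := h.represents
  have h₁ := hS.queue
  have h₂ := hS.head
  have e₁ := eval_lt hw.one_lt
    (eval_reg hr.head (hw.lt (hw.le_bound (by omega))))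
    (eval_reg hr.tail (hw.lt (hw.le_bound (by omega))))
  have e₂ := eval_eq hw.one_lt (eval_markExpr hw hS hr hr.sink) (eval_currentMark hw hS hr)
  simp only [hr.mem.mark t] at e₂
  exact ⟨e₁, eval_add e₁ e₂ (hw.lt (hw.le_bound (by split_ifs <;> omega)))⟩

/-- Every iteration strictly increases the potential, which is bounded because `F < n`; `N` is the
remaining room. This gives termination and the time bound at once. -/
theorem Maintains.runs_searchLoop (hw : WideWords n w) (hst : s ≠ t) (hL : L.Nodup)
    (hne : ∀ e ∈ L, e.1 ≠ e.2) (N : ℕ) : ∀ (σ : State) (S : Model n), Maintains s t L σ S →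
    L.length + n * (6 * L.length + 4) + (4 * L.length + 1) ≤ S.potential L.length + N →
    ∃ σ' S' K, Runs w searchLoop σ K σ' ∧ Maintains s t L σ' S' ∧
      S'.head = S'.queue.length ∧ t ∉ S'.queue ∧
      K + 1000 * S.potential L.length ≤ 1000 * S'.potential L.length + 100 := by
  have hbound : ∀ (σ : State) (S : Model n), Maintains s t L σ S → S.potential L.length ≤
      L.length + n * (6 * L.length + 4) + (4 * L.length + 1) := fun σ S h => by
    have h₁ := h.consistent.work_le
    have h₂ := Nat.mul_le_mul_right (6 * L.length + 4) (h.consistent.fits hL hne).value.le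
    unfold Model.potential
    omega
  have hdone : ∀ (σ : State) (S : Model n), Maintains s t L σ S →
      ¬ (S.head < S.queue.length ∨ t ∈ S.queue) →
      ∃ σ' S' K, Runs w searchLoop σ K σ' ∧ Maintains s t L σ' S' ∧
      S'.head = S'.queue.length ∧ t ∉ S'.queue ∧
      K + 1000 * S.potential L.length ≤ 1000 * S'.potential L.length + 100 := fun σ S h hc => by
    rw [not_or] at hc
    have e := (h.searchLoop_cond hw hL hne).2
    refine ⟨σ, S, 100, Runs.mono (Runs.loop_false ?_) (by decide), h,
      le_antisymm h.consistent.head_le (not_lt.1 hc.1), hc.2, by omega⟩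
    rw [e, if_neg hc.1, if_neg hc.2]
  -- The 90 steps set aside here pay for the loop test.
  have hstep : ∀ (σ : State) (S : Model n), Maintains s t L σ S →
      (S.head < S.queue.length ∨ t ∈ S.queue) →
      ∃ σ' S' K, Runs w (.branch (.lt (.reg 6) (.reg 7)) scanCmd augmentCmd) σ K σ' ∧
        Maintains s t L σ' S' ∧
        K + 90 + 1000 * S.potential L.length ≤ 1000 * S'.potential L.length := fun σ S h hc => by
    have e := (h.searchLoop_cond hw hL hne).1
    by_cases hh : S.head < S.queue.length
    · obtain ⟨σ', S', hrun, h', hp⟩ := h.scan hw hL hne hh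
      exact ⟨σ', S', _, Runs.branch_true (by rw [e]; simp [hh]) hrun, h', by
        simp only [Expr.cost]; omega⟩
    · obtain ⟨σ', S', K, hrun, h', hp⟩ := h.augment hw hst hL hne (hc.resolve_left hh)
      exact ⟨σ', S', _, Runs.branch_false (by rw [e]; simp [hh]) hrun, h', by
        simp only [Expr.cost]; omega⟩
  induction N with
  | zero =>
    intro σ S h hN
    refine hdone σ S h fun hc => ?_
    obtain ⟨σ', S', K, _, h', hp⟩ := hstep σ S h hc
    have := hbound σ' S' h'
    omega
  | succ N ih =>
    intro σ S h hN
    by_cases hc : S.head < S.queue.length ∨ t ∈ S.queue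
    · obtain ⟨σ₁, S₁, K₁, r₁, h₁, hp⟩ := hstep σ S h hc
      obtain ⟨σ', S', K, r, h', hd, ht, hp'⟩ := ih σ₁ S₁ h₁ (by omega)
      refine ⟨σ', S', _, Runs.loop_true ?_ r₁ r, h', hd, ht, ?_⟩
      · rw [(h.searchLoop_cond hw hL hne).2]
        rcases hc with hc | hc <;> simp [hc]
      · have : (Expr.add (.lt (.reg 6) (.reg 7))
          (.eq (markExpr (.reg 2)) currentMark)).cost ≤ 50 := by decide
        omega
    · exact hdone σ S h hc

theorem runs_recordCmd (hw : WideWords n w) {σ : State} {S : Model n} (hS : Fits S)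
    {u v : Fin n} (hS' : Fits (S.record u v)) (h : Represents s t σ S) (hu : σ.reg 0 = u)
    (hv : σ.reg 1 = v) :
    ∃ σ', Runs w recordCmd σ 300 σ' ∧ Represents s t σ' (S.record u v) ∧ σ'.reg = σ.reg := by
  have r₁ : Runs w (.store (cellExpr 0 (pairExpr (.reg 0) (.reg 1))) (.const 1)) σ _
      (σ.setMem (cell 0 (pairIndex n u v)) 1) :=
    Runs.store (hw.eval_cellExpr_pair h.size (hw.eval_vertex hu) (hw.eval_vertex hv)
      (hw.vertex_le u) v.isLt) (hw.eval_const (by omega))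
  have h₁ : Represents s t (σ.setMem (cell 0 (pairIndex n u v)) 1)
      (S.setMatrix (setEntry S.M u v 1)) :=
    ⟨h.mem.setMatrix u v 1, h.sink, h.size, h.source, h.value, h.head, h.tail, h.position⟩
  have hS₁ : Fits (S.setMatrix (setEntry S.M u v 1)) :=
    ⟨hS'.matrix, hS.degree, hS.queue, hS.head, hS.position, hS.value⟩
  obtain ⟨σ₂, r₂, h₂, e₂⟩ := runs_addNeighborCmd hw hS₁ h₁ (a := 0) (b := 1) hu hv
  -- Between the two list updates the degree sum is not yet twice the number of edges, so the degree
  -- bounds are taken from the final model.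
  have hS₂ : Fits ((S.setMatrix (setEntry S.M u v 1)).addNeighbor u v) :=
    ⟨hS'.matrix, fun a => (by
      rw [Model.record, length_addNeighbor _ v u]
      exact Nat.le_add_right _ _ : _ ≤ ((S.record u v).adj a).length).trans (hS'.degree a), hS.queue, hS.head,
      hS.position, hS.value⟩
  obtain ⟨σ₃, r₃, h₃, e₃⟩ := runs_addNeighborCmd hw hS₂ h₂ (a := 1) (b := 0)
    (by rw [e₂]; exact hv) (by rw [e₂]; exact hu)
  exact ⟨σ₃, Runs.mono (Runs.seq r₁ (Runs.seq r₂ r₃)) (by decide), h₃, e₃.trans e₂⟩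

theorem Maintains.runs_insertEdge (hw : WideWords n w) (hst : s ≠ t) {σ : State} {S : Model n}
    (h : Maintains s t L σ S) (hh : S.head = S.queue.length) {u v : Fin n}
    (hL : (L ++ [(u, v)]).Nodup) (hne : ∀ e ∈ L ++ [(u, v)], e.1 ≠ e.2) :
    ∃ σ' S' K, Runs w incrementalMaxFlow.insertEdge (σ.withPair u v) K σ' ∧
      Maintains s t (L ++ [(u, v)]) σ' S' ∧ S'.head = S'.queue.length ∧ t ∉ S'.queue ∧
      K + 1000 * S.potential L.length ≤ 1000 * S'.potential (L ++ [(u, v)]).length := by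
  have huv : (u, v) ∉ L := fun hc => (List.nodup_append.1 hL).2.2 _ hc _ (by simp) rfl
  have hc := h.consistent
  have hS := hc.fits (List.nodup_append.1 hL).1 fun e he => hne e (List.mem_append_left _ he)
  have hc₁ := hc.record hh huv
  have hS₁ := hc₁.fits hL hne
  have h₀ : Represents s t (σ.withPair u v) S :=
    (h.represents.setReg _ (by omega)).setReg _ (by omega)
  obtain ⟨σ₁, r₁, h₁, e₁⟩ := runs_recordCmd hw hS hS₁ h₀ (by simp [State.withPair])
    (by simp [State.withPair])
  have r₂ : Runs w (.assign 9 (.reg 0)) σ₁ _ (σ₁.setReg 9 u) :=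
    Runs.assign (hw.eval_vertex (by simp [e₁, State.withPair]))
  have r₃ : Runs w (.assign 10 (.reg 1)) (σ₁.setReg 9 u) _ ((σ₁.setReg 9 u).setReg 10 v) :=
    Runs.assign (hw.eval_vertex (by simp [e₁, State.withPair]))
  have h₃ : Represents s t ((σ₁.setReg 9 u).setReg 10 v) (S.record u v) :=
    (h₁.setReg _ (by omega)).setReg _ (by omega)
  set σ₃ := (σ₁.setReg 9 u).setReg 10 v with hσ₃
  have e₉ : σ₃.reg 9 = u := by simp [hσ₃]
  have e₁₀ : σ₃.reg 10 = v := by simp [hσ₃]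
  have ev₁ := eval_eq hw.one_lt (eval_markExpr hw hS₁ h₃ e₉) (eval_currentMark hw hS₁ h₃)
  have ev₂ := eval_lt hw.one_lt (eval_markExpr hw hS₁ h₃ e₁₀) (eval_currentMark hw hS₁ h₃)
  have ev₃ := eval_mul ev₁ ev₂ (hw.lt (hw.le_bound (by split_ifs <;> omega)))
  have hmu := h₃.mem.mark u
  have hmv := h₃.mem.mark v
  have hmv_le := h₃.mem.mark_le v
  have explore : ∃ σ₄ S₄, Runs w exploreCmd σ₁ 200 σ₄ ∧
      Maintains s t (L ++ [(u, v)]) σ₄ S₄ ∧ S₄.F = S.F ∧ S.work ≤ S₄.work := by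
    by_cases hv : u ∈ S.queue ∧ v ∉ S.queue
    · obtain ⟨σ₄, r₄, h₄⟩ := runs_visitCmd hw hS₁ h₃ e₉ e₁₀
      refine ⟨σ₄, _, Runs.mono (Runs.seq r₂ (Runs.seq r₃ (Runs.branch_true ?_ r₄))) (by decide),
        ⟨h₄, hc₁.visit hv.1 hv.2 ?_, hc.scanned_record_visit h.scanned hh huv⟩, rfl, ?_⟩
      · rw [ev₃, if_pos (hmu.2 hv.1), if_pos (lt_of_le_of_ne hmv_le fun hc => hv.2 (hmv.1 hc))]
        simp
      · exact (residual_setEntry ((hc.encodes.eq_zero u v).2 huv) _ _).2 (Or.inr ⟨rfl, rfl⟩)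
      · rw [work_visit hc₁.head_le]
        exact work_record_ge S u v
    · refine ⟨σ₃, _, Runs.mono (Runs.seq r₂ (Runs.seq r₃ (Runs.branch_false ?_ Runs.skip)))
        (by decide), ⟨h₃, hc₁, hc.scanned_record h.scanned hh huv (by tauto)⟩, rfl,
        work_record_ge S u v⟩
      rw [ev₃]
      by_cases hu : u ∈ S.queue
      · have : v ∈ S.queue := by tauto
        rw [hmv.2 this, if_neg (lt_irrefl _), mul_zero]
      · rw [if_neg fun hc => hu (hmu.1 hc), zero_mul]
  obtain ⟨σ₄, S₄, r₄, h₄, hF, hwk⟩ := explore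
  -- The room `N` is taken to be the entire bound on the potential.
  obtain ⟨σ', S', K, r₅, h₅, hd, ht, hp⟩ := h₄.runs_searchLoop hw hst hL hne _ σ₄ S₄
    (Nat.le_add_left _ _)
  refine ⟨σ', S', _, Runs.seq r₁ (Runs.seq r₄ r₅), h₅, hd, ht, ?_⟩
  -- The new edge itself adds one unit, that is 1000 steps, covering recording, exploring and the
  -- last loop test.
  have : S.potential L.length + 1 ≤ S₄.potential (L ++ [(u, v)]).length := by
    have : S.F * (6 * L.length + 4) ≤ S.F * (6 * (L.length + 1) + 4) :=
      Nat.mul_le_mul_left _ (by omega)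
    simp only [Model.potential, hF, List.length_append, List.length_singleton]
    omega
  omega

theorem Maintains.inserts (hw : WideWords n w) (hst : s ≠ t) (es : List (Fin n × Fin n)) :
    ∀ (L : List (Fin n × Fin n)) (σ : State) (S : Model n), Maintains s t L σ S →
    S.head = S.queue.length → t ∉ S.queue → (L ++ es).Nodup → (∀ e ∈ L ++ es, e.1 ≠ e.2) →
    ∃ k σ' S', Inserts w incrementalMaxFlow σ es k σ' ∧ Maintains s t (L ++ es) σ' S' ∧
      S'.head = S'.queue.length ∧ t ∉ S'.queue ∧
      k + 1000 * S.potential L.length ≤ 1000 * S'.potential (L ++ es).length := by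
  induction es with
  | nil =>
    intro L σ S h hh ht _ _
    exact ⟨0, σ, S, .nil σ, by simpa using h, hh, ht, by simp⟩
  | cons e es ih =>
    intro L σ S h hh ht hL hne
    obtain ⟨u, v⟩ := e
    rw [List.append_cons] at hL hne ⊢
    obtain ⟨σ₁, S₁, K, ⟨k, hk, hr⟩, h₁, hh₁, ht₁, hp₁⟩ := h.runs_insertEdge hw hst hh
      (List.nodup_append.1 hL).1 fun e he => hne e (List.mem_append_left _ he)
    obtain ⟨l, σ', S', hi, h', hh', ht', hp'⟩ := ih _ σ₁ S₁ h₁ hh₁ ht₁ hL hne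
    exact ⟨k + l, σ', S', .cons hr hi, h', hh', ht', by omega⟩

/-- The model of the empty graph. -/
def Model.empty (s : Fin n) : Model n where
  M _ _ := 0
  adj _ := []
  queue := [s]
  par _ := ⟨0, s.pos⟩
  head := 1
  i := 0
  F := 0

theorem consistent_empty (s t : Fin n) : Consistent s t [] (Model.empty s) where
  encodes := ⟨by simp [Model.empty], by simp [Model.empty],
    by simp [Model.empty, netFlow, unitFlow], by simp [Model.empty, netFlow, unitFlow]⟩
  mem_adj := by simp
  sum_adj := by simp [Model.empty]
  nodup := by simp [Model.empty]
  source_mem := by simp [Model.empty]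
  tree _ hv hvs := absurd (List.mem_singleton.1 hv) hvs
  head_le := le_rfl
  position_le h := absurd h (lt_irrefl 1)
  position_eq _ := rfl

theorem scanned_empty (s : Fin n) : Scanned (Model.empty s) where
  passed v _ x hr := by simp [Residual, Model.empty] at hr
  current h := absurd h (lt_irrefl 1)

theorem runs_setupCmd (hw : WideWords n w) (s t : Fin n) :
    ∃ σ, Runs w setupCmd (startState n s t) 100 σ ∧ Maintains s t [] σ (Model.empty s) := by
  have hn : n < 2 ^ w := hw.lt (hw.le_bound (by omega))
  refine ⟨_, Runs.mono (Runs.seq (Runs.assign (x := n) (eval_reg rfl hn)) (Runs.seq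
    (Runs.assign (x := s) (hw.eval_vertex rfl)) (Runs.seq (Runs.store (x := cell 5 0) (y := s)
      (hw.eval_cellExpr_single (hw.eval_const (by omega)) (by omega)) (hw.eval_vertex rfl))
    (Runs.seq (Runs.store (x := cell 3 s) (y := 1)
      (hw.eval_cellExpr_single (hw.eval_vertex rfl) (by omega)) (hw.eval_const (by omega)))
    (Runs.seq (Runs.assign (hw.eval_const (k := 1) (by omega)))
      (Runs.assign (hw.eval_const (k := 1) (by omega)))))))) (by decide),
    ⟨⟨?_, rfl, rfl, rfl, rfl, rfl, rfl, rfl⟩, consistent_empty s t, scanned_empty s⟩⟩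
  refine ⟨fun u v => ?_, fun u j hj => ?_, fun u => ?_, fun u => ?_, fun u => ?_, fun u => ?_,
    fun j hj => ?_⟩
  · simp [Model.empty, startState]
  · simp [Model.empty] at hj
  · simp [Model.empty, startState]
  · by_cases hu : u = s <;>
      simp [Model.empty, startState, Fin.val_inj, hu]
  · by_cases hu : u = s <;>
      simp [Model.empty, startState, Fin.val_inj, hu]
  · simp [Model.empty, startState]
  · have : j = 0 := by simpa [Model.empty] using hj
    subst this
    simp [Model.empty]

theorem flowAt_eq (hw : WideWords n w) {σ : State} {S : Model n} (hS : Fits S)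
    (h : Represents s t σ S) :
    (incrementalMaxFlow.flowAt w σ : Fin n → Fin n → ℝ) =
      fun u v => (unitFlow S.M u v : ℝ) := by
  funext u v
  have h' : Represents s t (σ.withPair u v) S :=
    (h.setReg _ (by omega)).setReg _ (by omega)
  have := eval_eq hw.one_lt (eval_matrixExpr hw hS h' (i := 0) (j := 1) (u := u) (v := v)
    (by simp [State.withPair]) (by simp [State.withPair])) (hw.eval_const (k := 2) (by omega))
  simp only [Algorithm.flowAt, incrementalMaxFlow, this, unitFlow]
  split_ifs <;> simp

end Correctness

end IncFlow

theorem theorem10 :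
    ∃ (A : IncFlow.Algorithm) (c C : ℕ),
      ∀ (n w : ℕ) (s t : Fin n), s ≠ t → n ^ c ≤ 2 ^ w →
        ∃ (k₀ : ℕ) (σ₀ : IncFlow.State),
          IncFlow.Exec w A.setup (IncFlow.startState n s t) k₀ σ₀ ∧ k₀ ≤ C ∧
          ∀ es : List (Fin n × Fin n), es.Nodup → (∀ e ∈ es, e.1 ≠ e.2) →
            ∃ (k : ℕ) (σ : IncFlow.State) (F : ℕ),
              IncFlow.Inserts w A σ₀ es k σ ∧
              IncFlow.IsMaxFlow {e | e ∈ es} s t (A.flowAt w σ) ∧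
              IncFlow.flowValue s (A.flowAt w σ) = (F : ℝ) ∧
              A.value.eval w σ = F ∧
              F < n ∧
              k ≤ C * (es.length * max F 1) := by
  -- The constant 16000 combines 1000 steps per unit of potential with the factor 16 of
  -- `Consistent.potential_le`.
  refine ⟨IncFlow.incrementalMaxFlow, 11, 16000, fun n w s t hst hnw => ?_⟩
  have hn : 2 ≤ n := by
    have := s.isLt
    have := t.isLt
    have := Fin.val_ne_of_ne hst
    omega
  have hw : IncFlow.WideWords n w := .of_pow_le hn hnw
  obtain ⟨σ₀, ⟨k₀, hk₀, hr⟩, h₀⟩ := IncFlow.runs_setupCmd hw s t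
  refine ⟨k₀, σ₀, hr, by omega, fun es hes hne => ?_⟩
  obtain ⟨k, σ, S, hi, h, hh, ht, hp⟩ := h₀.inserts hw hst es [] σ₀ _ rfl
    (fun hc => hst (List.mem_singleton.1 hc).symm) hes hne
  rw [List.nil_append] at h hp
  have hS := h.consistent.fits hes hne
  have hfl := IncFlow.flowAt_eq hw hS h.represents
  refine ⟨k, σ, S.F, hi, ?_, ?_, ?_, hS.value, ?_⟩
  · rw [hfl]
    exact h.consistent.isMaxFlow h.scanned hh ht
  · rw [hfl]
    exact h.consistent.encodes.flowValue_eq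
  · exact IncFlow.eval_reg h.represents.value
      (hw.lt (hw.le_bound (by have := hS.value; omega)))
  -- The potential of the empty graph is positive, so the case of no insertions is settled by the
  -- absence of steps.
  · rcases eq_or_ne es [] with rfl | he
    · cases hi
      simp
    · have := h.consistent.potential_le he
      omega
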